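/- Let $N\ge 0$ and let $\eta,\xi_1,\dots,\xi_N,\zeta,\kappa,\tau,\alpha,\beta,\alpha_-,\beta_-\in\mathbb C$ with $\sinh\zeta\neq0$, $\kappa\ne0$ and $$\sinh\alpha_-\cosh\beta_-=\frac{\sinh\zeta}{2\kappa},\qquad \cosh\alpha_-\sinh\beta_-=\frac{\cosh\zeta}{2\kappa}.$$ **Operators.** On $\mathcal H=(\mathbb C^2)^{\otimes N}$ and the auxiliary space $\mathcal H_0=\mathbb C^2$ put, with $R(\lambda)$ the $4\times4$ six-vertex matrix with nonzero entries $R_{11}=R_{44}=\sinh(\lambda+\eta)$, $R_{22}=R_{33}=\sinh\lambda$, $R_{23}=R_{32}=\sinh\eta$, $$M(\lambda)=R_{0N}(\lambda-\xi_N-\tfrac\eta2)\cdots R_{01}(\lambda-\xi_1-\tfrac\eta2),\qquad \hat M(\lambda)=(-1)^N\sigma_0^yM^{t_0}(-\lambda)\sigma^y_0,$$ $$K_-(\lambda)=\frac1{\sinh\zeta}\begin{pmatrix}\sinh(\lambda-\frac\eta2+\zeta)&\kappa e^{\tau}\sinh(2\lambda-\eta)\\ \kappa e^{-\tau}\sinh(2\lambda-\eta)&\sinh(\zeta-\lambda+\frac\eta2)\end{pmatrix},\qquad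 \mathcal U_-(\lambda)=M(\lambda)K_-(\lambda)\hat M(\lambda),$$ $$\tilde G(\lambda|\beta)=\begin{pmatrix}e^{-[\lambda+(\alpha+\beta+1)\eta]}&e^{-[\lambda+(\alpha-\beta+1)\eta]}\\1&1\end{pmatrix},$$ and define $\mathcal A_-,\mathcal B_-,\mathcal C_-,\mathcal D_-$ by $$e^{-\lambda+\eta/2}\,\tilde G^{-1}(\lambda-\tfrac\eta2|\beta)\,\mathcal U_-(\lambda)\,\tilde G(\tfrac\eta2-\lambda|\beta)=\begin{pmatrix}\mathcal A_-(\lambda|\beta+2)&\mathcal B_-(\lambda|\beta)\\ \mathcal C_-(\lambda|\beta+2)&\mathcal D_-(\lambda|\beta)\end{pmatrix}.$$ **Functions and states.** Put $a(\lambda)=\prod_n\sinh(\lambda-\xi_n+\frac\eta2)$, $d(\lambda)=a(\lambda-\eta)$, $$g_-(\lambda)=\frac{\sinh(\lambda+\alpha_--\frac\eta2)\cosh(\lambda+\beta_--\frac\eta2)}{\sinh\alpha_-\cosh\beta_-},\qquad \mathsf A_-(\lambda)=g_-(\lambda)a(\lambda)d(-\lambda),$$ $$f_n(\beta)=\frac{\sinh(2\xi_n+\eta)\sinh\beta\eta}{\sinh(2\xi_n-\eta)\sinh(2\xi_n+\beta\eta)},\qquad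 |\beta\rangle=\bigotimes_{n=1}^N\begin{pmatrix}e^{-\alpha\eta-(N-n+\beta)\eta-\xi_n}\\1\end{pmatrix},$$ and, for $\mathbf h=(h_1,\dots,h_N)\in\{0,1\}^N$, $a_{\mathbf h}(\lambda)=\prod_n\sinh(\lambda-\xi_n-(h_n-\frac12)\eta)$ and $$|\beta,\mathbf h\rangle=\prod_{n=1}^N\left(\frac{\mathcal D_-(\xi_n+\eta/2|\beta)}{f_n(\beta)\,\mathsf A_-(\eta/2-\xi_n)}\right)^{1-h_n}|-\beta+2\rangle .$$ **Genericity.** Assume: * for $r\in\{-1,0,1\}$: $\sinh(\xi_a-\xi_b+r\eta)\neq0$ for all $a\ne b$, and $\sinh(\xi_a+\xi_b+r\eta)\ne0$ for all $a,b$ (including $a=b$); * $\mathsf A_-(\eta/2-\xi_n)\neq0$ for all $n$; * $\sinh\beta\eta\ne0$, $\sinh(\beta+2)\eta\neq0$, and $\sinh(2\xi_n+\beta\eta)\neq0$, $\sinh(2\xi_n+(\beta+2)\eta)\ne0$ for all $n$. **Theorem (right $\mathcal B_-(\lambda|\beta)$ SOV-basis).** 1. The state $|\beta,\mathbf h\rangle$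 does not depend on the order of the factors in its definition. 2. If $$(\alpha-\beta-2j)\eta\neq-(N+1)\eta-\tau-(-1)^k(\alpha_-+\beta_-)+i\pi k\qquad\text{for all }k\in\mathbb Z\text{ and }j=0,1,\dots,N-1,$$ then the states $|\beta,\mathbf h\rangle$, $\mathbf h\in\{0,1\}^N$, form a basis of $\mathcal H$. 3. For all $\mathbf h\in\{0,1\}^N$ and all $\lambda\in\mathbb C$, $$\mathcal B_-(\lambda|\beta)\,|\beta,\mathbf h\rangle=|\beta+2,\mathbf h\rangle\,\bar{\mathsf B}_{\mathbf h}(\lambda|\beta),$$ where $$\bar{\mathsf B}_{\mathbf h}(\lambda|\beta)=(-1)^Ne^{(\beta-N)\eta}\prod_{n=1}^N\left(\frac{f_n(\beta+2)}{f_n(\beta)}\right)^{1-h_n}a_{\mathbf h}(\lambda)a_{\mathbf h}(-\lambda)\,\frac{\sinh(2\lambda-\eta)\left(2\kappa\sinh[(\beta-(1+N+\alpha))\eta-\tau]-e^{\zeta}\right)}{2\sinh\zeta\,\sinh\beta\eta}.$$ -/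

import Mathlib

namespace OpenXXZ

open Complex

noncomputable section

/-- Complex parameters of an inhomogeneous open XXZ spin-1/2 chain with `N` sites: the crossing
parameter `η`, the inhomogeneities `ξ`, the parameters `ζ, κ, τ` of the boundary matrix `K₋`,
a second set of parameters `αb, βb` (the numbers usually written `α₋, β₋`, tied to `ζ, κ` by
`Params.BoundaryRelation`), and the first parameter `α` of the gauge transformation. -/
structure Params (N : ℕ) where
  η : ℂ
  ξ : Fin N → ℂ
  ζ : ℂ
  κ : ℂ
  τ : ℂ
  αb : ℂ
  βb : ℂ
  α : ℂ

/-- The space `(ℂ²)^{⊗ N}`, in coordinates with respect to the product basis: the pure tensor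
`v₁ ⊗ ⋯ ⊗ v_N` is the function `h ↦ ∏ n, v_n (h n)`. The index `0` is the upper entry of a
column of `ℂ²`, the index `1` the lower one. -/
abbrev State (N : ℕ) : Type := (Fin N → Fin 2) → ℂ

/-- Operators on `(ℂ²)^{⊗ N}`. -/
abbrev Op (N : ℕ) : Type := Matrix (Fin N → Fin 2) (Fin N → Fin 2) ℂ

/-- Operators on `ℂ² ⊗ (ℂ²)^{⊗ N}` (auxiliary space first), as `2 × 2` matrices of operators. -/
abbrev AuxOp (N : ℕ) : Type := Matrix (Fin 2) (Fin 2) (Op N)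

/-- A scalar `2 × 2` matrix acting on the auxiliary space only. -/
def onAux {N : ℕ} (X : Matrix (Fin 2) (Fin 2) ℂ) : AuxOp N := X.map (algebraMap ℂ (Op N))

/-- The trigonometric six-vertex `R`-matrix on `ℂ² ⊗ ℂ²`, in the basis ordered as
`(0,0), (0,1), (1,0), (1,1)`. -/
def rMatrix (η l : ℂ) : Matrix (Fin 2 × Fin 2) (Fin 2 × Fin 2) ℂ :=
  Matrix.submatrix
    !![sinh (l + η), 0, 0, 0;
       0, sinh l, sinh η, 0;
       0, sinh η, sinh l, 0;
       0, 0, 0, sinh (l + η)]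
    (finProdFinEquiv : Fin 2 × Fin 2 ≃ Fin (2 * 2)) (finProdFinEquiv : Fin 2 × Fin 2 ≃ Fin (2 * 2))

/-- The Pauli matrix `σ^y`. -/
def sigmaY : Matrix (Fin 2) (Fin 2) ℂ := !![0, -I; I, 0]

namespace Params

variable {N : ℕ} (P : Params N)

/-- `sinh α₋ cosh β₋ = sinh ζ₋ / (2 κ₋)` and `cosh α₋ sinh β₋ = cosh ζ₋ / (2 κ₋)`. -/
def BoundaryRelation : Prop :=
  sinh P.αb * cosh P.βb = sinh P.ζ / (2 * P.κ) ∧ cosh P.αb * sinh P.βb = cosh P.ζ / (2 * P.κ)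

/-- `R_{0 a}(l)`: the `R`-matrix on the auxiliary space and the site `a`, the identity on the
other sites. -/
def rSite (a : Fin N) (l : ℂ) : AuxOp N :=
  Matrix.of fun i j => Matrix.of fun h k =>
    if ∀ b, b ≠ a → h b = k b then rMatrix P.η l (i, h a) (j, k a) else 0

/-- Bulk monodromy matrix `M(l) = R_{0N}(l - ξ_N - η/2) ⋯ R_{01}(l - ξ_1 - η/2)`. -/
def bulkM (l : ℂ) : AuxOp N :=
  ((List.finRange N).reverse.map fun a => P.rSite a (l - P.ξ a - P.η / 2)).prod

/-- `M̂(l) = (-1)^N σ^y M^{t₀}(-l) σ^y`; the transposition is in the auxiliary space only. -/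
def bulkMhat (l : ℂ) : AuxOp N :=
  ((-1 : ℂ) ^ N) • (onAux sigmaY * (P.bulkM (-l)).transpose * onAux sigmaY)

/-- The boundary matrix `K₋(l)`. -/
def kMinus (l : ℂ) : Matrix (Fin 2) (Fin 2) ℂ :=
  (1 / sinh P.ζ) •
    !![sinh (l - P.η / 2 + P.ζ), P.κ * exp P.τ * sinh (2 * l - P.η);
       P.κ * exp (-P.τ) * sinh (2 * l - P.η), sinh (P.ζ - l + P.η / 2)]

/-- The double-row monodromy matrix `𝒰₋(l) = M(l) K₋(l) M̂(l)`. -/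
def uMinus (l : ℂ) : AuxOp N := P.bulkM l * onAux (P.kMinus l) * P.bulkMhat l

/-- The column `X(l|β)`. -/
def colX (l β : ℂ) : Fin 2 → ℂ := ![exp (-(l + (P.α + β) * P.η)), 1]

/-- The column `Y(l|β)`. -/
def colY (l β : ℂ) : Fin 2 → ℂ := ![exp (-(l + (P.α - β) * P.η)), 1]

/-- The gauge matrix `G̃(l|β)`, with columns `X(l|β+1)` and `Y(l|β-1)`. -/
def gaugeG (l β : ℂ) : Matrix (Fin 2) (Fin 2) ℂ :=
  (Matrix.of ![P.colX l (β + 1), P.colY l (β - 1)]).transpose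

/-- The gauge transformed double-row monodromy matrix
`𝒰₋(l|β) = e^{-l + η/2} G̃⁻¹(l - η/2|β) 𝒰₋(l) G̃(η/2 - l|β)`, whose entries are
`𝒜₋(l|β+2), ℬ₋(l|β)` in the first row and `𝒞₋(l|β+2), 𝒟₋(l|β)` in the second. -/
def gaugedU (l β : ℂ) : AuxOp N :=
  exp (-l + P.η / 2) •
    (onAux (P.gaugeG (l - P.η / 2) β)⁻¹ * P.uMinus l * onAux (P.gaugeG (P.η / 2 - l) β))

/-- The operator `ℬ₋(l|β)`. -/
def opB (l β : ℂ) : Op N := P.gaugedU l β 0 1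

/-- The operator `𝒟₋(l|β)`. -/
def opD (l β : ℂ) : Op N := P.gaugedU l β 1 1

/-- The reference state `|β⟩ = ⊗_n (e^{-αη - (N - n + β)η - ξ_n}, 1)ᵗ`, with `n` running from `1`
to `N`; the number of a site `n : Fin N` is `n + 1`. -/
def refKet (β : ℂ) : State N := fun h =>
  ∏ n : Fin N,
    (![exp (-P.α * P.η - ((N : ℂ) - ((n : ℕ) + 1 : ℂ) + β) * P.η - P.ξ n), 1] : Fin 2 → ℂ) (h n)

/-- `a(l) = ∏_n sinh(l - ξ_n + η/2)`. -/
def fnA (l : ℂ) : ℂ := ∏ n, sinh (l - P.ξ n + P.η / 2)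

/-- `d(l) = a(l - η)`. -/
def fnD (l : ℂ) : ℂ := P.fnA (l - P.η)

/-- The function `g₋`. -/
def fnG (l : ℂ) : ℂ :=
  sinh (l + P.αb - P.η / 2) * cosh (l + P.βb - P.η / 2) / (sinh P.αb * cosh P.βb)

/-- The function `A₋(l) = g₋(l) a(l) d(-l)`. -/
def eigA (l : ℂ) : ℂ := P.fnG l * P.fnA l * P.fnD (-l)

/-- The coefficient `f_n(β)`. -/
def coefF (n : Fin N) (β : ℂ) : ℂ :=
  sinh (2 * P.ξ n + P.η) * sinh (β * P.η) /
    (sinh (2 * P.ξ n - P.η) * sinh (2 * P.ξ n + β * P.η))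

/-- The state `∏_n (𝒟₋(ξ_n + η/2|β) / (f_n(β) A₋(η/2 - ξ_n)))^{1 - h_n} |-β+2⟩`, the factors being
multiplied in the order in which the sites are listed in `L`. -/
def sovKetOrdered (L : List (Fin N)) (β : ℂ) (h : Fin N → Fin 2) : State N :=
  (L.map fun n =>
    ((P.coefF n β * P.eigA (P.η / 2 - P.ξ n))⁻¹ • P.opD (P.ξ n + P.η / 2) β)
      ^ (1 - (h n : ℕ))).prod.mulVec (P.refKet (-β + 2))

/-- The state `|β, h⟩`, with the factors in the order `n = 1, …, N`. -/
def sovKet (β : ℂ) (h : Fin N → Fin 2) : State N := P.sovKetOrdered (List.finRange N) β h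

/-- `a_h(l) = ∏_n sinh(l - ξ_n - (h_n - 1/2) η)`. -/
def fnAh (h : Fin N → Fin 2) (l : ℂ) : ℂ :=
  ∏ n, sinh (l - P.ξ n - (((h n : ℕ) : ℂ) - 1 / 2) * P.η)

/-- The right pseudo-eigenvalue `B̄_h(l|β)`. -/
def eigBbar (h : Fin N → Fin 2) (l β : ℂ) : ℂ :=
  (-1) ^ N * exp ((β - N) * P.η) *
    (∏ n, (P.coefF n (β + 2) / P.coefF n β) ^ (1 - (h n : ℕ))) *
    P.fnAh h l * P.fnAh h (-l) *
    (sinh (2 * l - P.η) *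
        (2 * P.κ * sinh ((β - (1 + N + P.α)) * P.η - P.τ) - exp P.ζ) /
      (2 * sinh P.ζ * sinh (β * P.η)))

/-- Non-resonance of the inhomogeneities: no `ξ_a - ξ_b + rη` with `a ≠ b`, and no
`ξ_a + ξ_b + rη` (`a = b` allowed), lies in `iπℤ`, for `r = -1, 0, 1`. -/
def NonResonant : Prop :=
  ∀ r : ℤ, r ∈ ({-1, 0, 1} : Finset ℤ) →
    (∀ a b : Fin N, a ≠ b → sinh (P.ξ a - P.ξ b + r * P.η) ≠ 0) ∧
    (∀ a b : Fin N, sinh (P.ξ a + P.ξ b + r * P.η) ≠ 0)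

/-- Non-nilpotency condition on the gauge parameters: for every integer `k`,
`(α - β)η ≠ -(N + 1)η - τ₋ - (-1)^k (α₋ + β₋) + iπk`. -/
def NonNilpotentRight (β : ℂ) : Prop :=
  ∀ k : ℤ, (P.α - β) * P.η ≠
    -((N : ℂ) + 1) * P.η - P.τ - (-1 : ℂ) ^ k * (P.αb + P.βb) + I * Real.pi * k

end Params

end

end OpenXXZ

/-! Write `q` for the exponential of `-(α - β + 1)η`, `X = e^{λ - η/2}`, `t = e^η`. Up to the scalar
`(p - q)⁻¹`, with `p` the exponential of `-(α + β + 1)η`, the operator `ℬ₋` is `B_q(λ) = (1, -q/X)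
𝒰₋ (qX, 1)ᵗ`. Moreover `𝒟₋` is `X⁻¹ D_q(λ)`, with `D_q = (0, 1) 𝒰₋ (qX, 1)ᵗ`, minus that same
multiple of `B_q`. On vectors killed by `B_q(λ)`, `𝒟₋` is therefore a multiple of `D_q`, and `p`
disappears.

The reflection equation for `𝒰₋` (`uMinus_reflection`) gives two exchange relations. By
`bForm_mul_dForm`, `B_q(λ) D_q(μ)` is a scalar times `D_{qt²}(μ) B_q(λ)`, modulo operators ending in
`B_q(μ)`. By `dForm_mul_dForm`, the operators `D_q` commute modulo operators ending in `B_q`. The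
reference state is a pseudo-eigenvector of `B_q(λ)`, by peeling off one site at a time. Its
pseudo-eigenvalue vanishes at every `λ = ξ_n + η/2`, so the unwanted terms drop out when `D_q(ξ_n +
η/2)` is applied; this moves the zero at `ξ_n + η/2` to `ξ_n - η/2` and leaves the other zeros `ξ_m
+ η/2` in place. Induction over the sites used gives part 3 (`bOp_mulVec_phi`) and the independence
of order (`phi_perm`).

For the basis, the states are shown to span, by induction on `N` (`span_phi_eq_top`). Splitting off
the last site, with local vector `v`, the states not using that site yield all `ψ ⊗ v`. Those using
it yield, modulo `ψ ⊗ v`, all `ψ ⊗ (1, 0)`, built on the shorter chain at `qt²`. The shift accounts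
for the conditions at `β + 2j`. Since there are `2^N` states, spanning suffices. -/

namespace OpenXXZ

open Complex Matrix

noncomputable section

/-! ### Tensor products with a last site -/

/-- The operator `X ⊗ Y` on `n + 1` sites, where `Y` acts on the last site. -/
def kr {n : ℕ} (X : Op n) (Y : Matrix (Fin 2) (Fin 2) ℂ) : Op (n + 1) :=
  Matrix.of fun h k => X (Fin.init h) (Fin.init k) * Y (h (Fin.last n)) (k (Fin.last n))

/-- The state `ψ ⊗ v` on `n + 1` sites, where `v` sits on the last site. -/
def ten {n : ℕ} (ψ : State n) (v : Fin 2 → ℂ) : State (n + 1) :=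
  fun h => ψ (Fin.init h) * v (h (Fin.last n))

theorem sum_snoc {n : ℕ} {M : Type*} [AddCommMonoid M] (f : (Fin (n + 1) → Fin 2) → M) :
    ∑ h, f h = ∑ g : Fin n → Fin 2, ∑ i : Fin 2, f (Fin.snoc (α := fun _ => Fin 2) g i) := by
  rw [← (Fin.snocEquiv fun _ => Fin 2).sum_comp, Fintype.sum_prod_type, Finset.sum_comm]
  rfl

theorem kr_mul_kr {n : ℕ} (X X' : Op n) (Y Y' : Matrix (Fin 2) (Fin 2) ℂ) :
    kr X Y * kr X' Y' = kr (X * X') (Y * Y') := by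
  ext h k
  simp only [kr, Matrix.mul_apply, Matrix.of_apply, sum_snoc, Fin.init_snoc, Fin.snoc_last,
    Finset.sum_mul_sum]
  exact Finset.sum_congr rfl fun _ _ => Finset.sum_congr rfl fun _ _ => by ring

theorem kr_mulVec_ten {n : ℕ} (X : Op n) (Y : Matrix (Fin 2) (Fin 2) ℂ) (ψ : State n)
    (v : Fin 2 → ℂ) : (kr X Y).mulVec (ten ψ v) = ten (X.mulVec ψ) (Y.mulVec v) := by
  ext h
  simp only [kr, ten, Matrix.mulVec, dotProduct, Matrix.of_apply, sum_snoc, Fin.init_snoc,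
    Fin.snoc_last, Finset.sum_mul_sum]
  exact Finset.sum_congr rfl fun _ _ => Finset.sum_congr rfl fun _ _ => by ring

theorem kr_one_one {n : ℕ} : kr (1 : Op n) 1 = 1 := by
  ext h k
  have : h = k ↔ Fin.init h = Fin.init k ∧ h (Fin.last n) = k (Fin.last n) := by
    constructor
    · rintro rfl; exact ⟨rfl, rfl⟩
    · rintro ⟨h1, h2⟩
      rw [← Fin.snoc_init_self h, ← Fin.snoc_init_self k, h1, h2]
  simp only [kr, Matrix.of_apply, Matrix.one_apply, this]
  split_ifs <;> simp_all

section linear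
variable {n : ℕ}

theorem kr_add_left (X X' : Op n) (Y) : kr (X + X') Y = kr X Y + kr X' Y := by
  ext; simp [kr, add_mul]
theorem kr_add_right (X : Op n) (Y Y') : kr X (Y + Y') = kr X Y + kr X Y' := by
  ext; simp [kr, mul_add]
theorem kr_smul_left (c : ℂ) (X : Op n) (Y) : kr (c • X) Y = c • kr X Y := by
  ext; simp [kr, mul_assoc]
theorem kr_smul_right (c : ℂ) (X : Op n) (Y) : kr X (c • Y) = c • kr X Y := by
  ext; simp [kr, mul_left_comm]
theorem ten_add_left (ψ ψ' : State n) (v) : ten (ψ + ψ') v = ten ψ v + ten ψ' v := by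
  ext; simp [ten, add_mul]
theorem ten_smul_left (c : ℂ) (ψ : State n) (v) : ten (c • ψ) v = c • ten ψ v := by
  ext; simp [ten, mul_assoc]

end linear

/-- `X ↦ X ⊗ 1`. -/
def liftHom (n : ℕ) : Op n →ₐ[ℂ] Op (n + 1) :=
  AlgHom.ofLinearMap
    { toFun := fun X => kr X 1
      map_add' := fun X X' => kr_add_left X X' 1
      map_smul' := fun c X => kr_smul_left c X 1 }
    kr_one_one (fun X X' => by simp [kr_mul_kr])

/-- `Y ↦ 1 ⊗ Y`, with `Y` on the last site. -/
def siteHom (n : ℕ) : Matrix (Fin 2) (Fin 2) ℂ →ₐ[ℂ] Op (n + 1) :=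
  AlgHom.ofLinearMap
    { toFun := fun Y => kr 1 Y
      map_add' := fun Y Y' => kr_add_right 1 Y Y'
      map_smul' := fun c Y => kr_smul_right c 1 Y }
    kr_one_one (fun Y Y' => by simp [kr_mul_kr])

theorem liftHom_apply {n : ℕ} (X : Op n) : liftHom n X = kr X 1 := rfl
theorem siteHom_apply {n : ℕ} (Y) : siteHom n Y = kr 1 Y := rfl

theorem commute_lift_site {n : ℕ} (X : Op n) (Y) : Commute (liftHom n X) (siteHom n Y) := by
  simp [Commute, SemiconjBy, liftHom_apply, siteHom_apply, kr_mul_kr]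

/-! ### Recursion of the monodromy matrices in the number of sites -/

/-- The `R`-matrix as a `2 × 2` matrix (auxiliary space) of `2 × 2` matrices (one site). -/
def rBlock (η u : ℂ) : Matrix (Fin 2) (Fin 2) (Matrix (Fin 2) (Fin 2) ℂ) :=
  !![!![sinh (u + η), 0; 0, sinh u], !![0, 0; sinh η, 0];
     !![0, sinh η; 0, 0], !![sinh u, 0; 0, sinh (u + η)]]

theorem rBlock_apply (η u : ℂ) (i j a b : Fin 2) :
    rBlock η u i j a b = rMatrix η u (i, a) (j, b) := by
  fin_cases i <;> fin_cases j <;> fin_cases a <;> fin_cases b <;>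
    simp [rBlock, rMatrix, finProdFinEquiv]

/-- The chain without its last site. -/
def Params.init {n : ℕ} (P : Params (n + 1)) : Params n :=
  { P with ξ := fun a => P.ξ a.castSucc }

section

variable {n : ℕ} (P : Params (n + 1))

theorem rSite_last (l : ℂ) : P.rSite (Fin.last n) l = (rBlock P.η l).map (siteHom n) := by
  ext i j h k
  simp only [Params.rSite, Matrix.of_apply, Matrix.map_apply, siteHom_apply, kr, rBlock_apply,
    Matrix.one_apply]
  have : (∀ b, b ≠ Fin.last n → h b = k b) ↔ Fin.init h = Fin.init k := by
    constructor
    · intro H; funext b; exact H _ (Fin.castSucc_lt_last b).ne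
    · intro H b hb
      obtain ⟨c, rfl⟩ := Fin.exists_castSucc_eq.2 hb
      exact congrFun H c
  simp only [this]
  split_ifs <;> simp

theorem rSite_castSucc (a : Fin n) (l : ℂ) :
    P.rSite a.castSucc l = (P.init.rSite a l).map (liftHom n) := by
  ext i j h k
  simp only [Params.rSite, Matrix.of_apply, Matrix.map_apply, liftHom_apply, kr,
    Matrix.one_apply]
  have : (∀ b, b ≠ a.castSucc → h b = k b) ↔
      (∀ b, b ≠ a → Fin.init h b = Fin.init k b) ∧ h (Fin.last n) = k (Fin.last n) := by
    constructor
    · intro H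
      exact ⟨fun b hb => H _ (by simpa using hb), H _ (Fin.castSucc_lt_last a).ne'⟩
    · rintro ⟨H1, H2⟩ b hb
      rcases Fin.eq_castSucc_or_eq_last b with ⟨c, rfl⟩ | rfl
      · exact H1 c (by simpa using hb)
      · exact H2
  by_cases h2 : h (Fin.last n) = k (Fin.last n)
  · by_cases h1 : ∀ b, b ≠ a → Fin.init h b = Fin.init k b
    · rw [if_pos (this.2 ⟨h1, h2⟩), if_pos h1, if_pos h2, mul_one]
      rfl
    · rw [if_neg fun H => h1 (this.1 H).1, if_neg h1, zero_mul]
  · rw [if_neg fun H => h2 (this.1 H).2, if_neg h2, mul_zero]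

theorem bulkM_succ (l : ℂ) :
    P.bulkM l = (rBlock P.η (l - P.ξ (Fin.last n) - P.η / 2)).map (siteHom n) *
      (P.init.bulkM l).map (liftHom n) := by
  have : ∀ L : List (Fin n),
      ((L.map Fin.castSucc).map fun a => P.rSite a (l - P.ξ a - P.η / 2)).prod =
        ((L.map fun a => P.init.rSite a (l - P.init.ξ a - P.init.η / 2)).prod).map
          (liftHom n) := by
    intro L
    induction L with
    | nil => simp
    | cons a L ih =>
      simp only [List.map_cons, List.prod_cons, ih, rSite_castSucc, Matrix.map_mul]
      rfl
  simp only [Params.bulkM, List.finRange_succ_last, List.reverse_append, List.reverse_cons, List.reverse_nil,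
    List.nil_append, List.map_append, List.map_cons, List.map_nil, List.prod_append,
    List.prod_cons, List.prod_nil, mul_one, rSite_last]
  rw [← List.map_reverse, this]

theorem onAux_map_lift (X : Matrix (Fin 2) (Fin 2) ℂ) :
    (onAux X : AuxOp n).map (liftHom n) = onAux X := by
  ext1 i j
  simp only [onAux, Matrix.map_apply, AlgHom.commutes]

theorem onAux_map_site (X : Matrix (Fin 2) (Fin 2) ℂ) :
    (X.map (algebraMap ℂ (Matrix (Fin 2) (Fin 2) ℂ))).map (siteHom n) = onAux X := by
  ext1 i j
  simp only [onAux, Matrix.map_apply, AlgHom.commutes]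

/-- Crossing symmetry of the `R`-matrix. -/
theorem rBlock_crossing (η u : ℂ) :
    -(sigmaY.map (algebraMap ℂ (Matrix (Fin 2) (Fin 2) ℂ)) * (rBlock η u)ᵀ *
      sigmaY.map (algebraMap ℂ (Matrix (Fin 2) (Fin 2) ℂ))) = rBlock η (-u - η) := by
  have h1 : sinh (-u - η) = -sinh (u + η) := by rw [← sinh_neg]; ring_nf
  have h2 : sinh (-u) = -sinh u := sinh_neg u
  ext i j a b
  fin_cases i <;> fin_cases j <;> fin_cases a <;> fin_cases b <;>
    simp [rBlock, sigmaY, Matrix.mul_apply, Fin.sum_univ_two, Algebra.algebraMap_eq_smul_one,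
      h1, h2, ← mul_assoc]

/-- Auxiliary transposition reverses a product of operator-valued matrices only because entries on
different sites commute. -/
theorem transpose_map_mul_map (A : Matrix (Fin 2) (Fin 2) (Matrix (Fin 2) (Fin 2) ℂ))
    (B : AuxOp n) :
    (A.map (siteHom n) * B.map (liftHom n))ᵀ = (B.map (liftHom n))ᵀ * (A.map (siteHom n))ᵀ := by
  ext1 i j
  simp only [Matrix.transpose_apply, Matrix.mul_apply, Matrix.map_apply]
  exact Finset.sum_congr rfl fun a _ => ((commute_lift_site _ _).eq).symm

theorem onAux_mul {N : ℕ} (X Y : Matrix (Fin 2) (Fin 2) ℂ) :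
    (onAux (X * Y) : AuxOp N) = onAux X * onAux Y := by
  simp only [onAux, Matrix.map_mul]

theorem sigmaY_mul_self : sigmaY * sigmaY = 1 := by
  ext i j; fin_cases i <;> fin_cases j <;> simp [sigmaY]

theorem onAux_sigmaY_mul_self {N : ℕ} : (onAux sigmaY : AuxOp N) * onAux sigmaY = 1 := by
  rw [← onAux_mul, sigmaY_mul_self]; simp [onAux]

/-- Crossing turns the conjugated transpose of the last `R` back into an `R`, absorbing one sign of
`(-1)^N`. Hence `𝒰₋` grows by one `R` on each side. -/
theorem bulkMhat_succ (l : ℂ) :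
    P.bulkMhat l = (P.init.bulkMhat l).map (liftHom n) *
      (rBlock P.η (l + P.ξ (Fin.last n) - P.η / 2)).map (siteHom n) := by
  have h := rBlock_crossing P.η (-l - P.ξ (Fin.last n) - P.η / 2)
  rw [show -(-l - P.ξ (Fin.last n) - P.η / 2) - P.η = l + P.ξ (Fin.last n) - P.η / 2 by ring] at h
  rw [← h]
  have h3 : ∀ A : Matrix (Fin 2) (Fin 2) (Matrix (Fin 2) (Fin 2) ℂ),
      (-A).map (siteHom n) = -(A.map (siteHom n)) := by intro A; ext1; simp
  have h4 : ∀ (c : ℂ) (A : AuxOp n), (c • A).map (liftHom n) = c • A.map (liftHom n) := by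
    intro c A; ext1; simp
  simp only [Params.bulkMhat, bulkM_succ, transpose_map_mul_map, h3, Matrix.map_mul, h4,
    onAux_map_lift, onAux_map_site, pow_succ, Matrix.transpose_map]
  have h5 := onAux_sigmaY_mul_self (N := n + 1)
  generalize (onAux sigmaY : AuxOp (n + 1)) = s at *
  simp only [mul_neg, mul_one, neg_smul, smul_mul_assoc, mul_assoc]
  rw [← mul_assoc s s, h5, one_mul]

theorem uMinus_succ (l : ℂ) :
    P.uMinus l = (rBlock P.η (l - P.ξ (Fin.last n) - P.η / 2)).map (siteHom n) *
      (P.init.uMinus l).map (liftHom n) *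
      (rBlock P.η (l + P.ξ (Fin.last n) - P.η / 2)).map (siteHom n) := by
  simp only [Params.uMinus, bulkM_succ, bulkMhat_succ, Matrix.map_mul, onAux_map_lift, mul_assoc]
  rfl

theorem uMinus_succ_apply (l : ℂ) (i j : Fin 2) :
    P.uMinus l i j = ∑ b, ∑ a, kr (P.init.uMinus l a b)
      (rBlock P.η (l - P.ξ (Fin.last n) - P.η / 2) i a *
        rBlock P.η (l + P.ξ (Fin.last n) - P.η / 2) b j) := by
  simp only [uMinus_succ, Matrix.mul_apply, Matrix.map_apply, Finset.sum_mul, siteHom_apply,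
    liftHom_apply, kr_mul_kr, one_mul, mul_one]

end

/-! ### Yang–Baxter and reflection equations -/

theorem rMatrix_entries (η u : ℂ) :
    rMatrix η u (0, 0) (0, 0) = sinh (u + η) ∧
    rMatrix η u (0, 0) (0, 1) = 0 ∧
    rMatrix η u (0, 0) (1, 0) = 0 ∧
    rMatrix η u (0, 0) (1, 1) = 0 ∧
    rMatrix η u (0, 1) (0, 0) = 0 ∧
    rMatrix η u (0, 1) (0, 1) = sinh u ∧
    rMatrix η u (0, 1) (1, 0) = sinh η ∧
    rMatrix η u (0, 1) (1, 1) = 0 ∧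
    rMatrix η u (1, 0) (0, 0) = 0 ∧
    rMatrix η u (1, 0) (0, 1) = sinh η ∧
    rMatrix η u (1, 0) (1, 0) = sinh u ∧
    rMatrix η u (1, 0) (1, 1) = 0 ∧
    rMatrix η u (1, 1) (0, 0) = 0 ∧
    rMatrix η u (1, 1) (0, 1) = 0 ∧
    rMatrix η u (1, 1) (1, 0) = 0 ∧
    rMatrix η u (1, 1) (1, 1) = sinh (u + η) := by
  simp [rMatrix, finProdFinEquiv]

section reflection

variable {A B : Type*} [Ring A] [Ring B]

/-- A matrix acting on the first of two auxiliary spaces. -/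
def inFst (U : Matrix (Fin 2) (Fin 2) A) : Matrix (Fin 2 × Fin 2) (Fin 2 × Fin 2) A :=
  Matrix.of fun i j => if i.2 = j.2 then U i.1 j.1 else 0

/-- A matrix acting on the second of two auxiliary spaces. -/
def inSnd (U : Matrix (Fin 2) (Fin 2) A) : Matrix (Fin 2 × Fin 2) (Fin 2 × Fin 2) A :=
  Matrix.of fun i j => if i.1 = j.1 then U i.2 j.2 else 0

theorem inFst_mul (U V : Matrix (Fin 2) (Fin 2) A) : inFst (U * V) = inFst U * inFst V := by
  ext ⟨i, i'⟩ ⟨j, j'⟩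
  fin_cases i' <;> fin_cases j' <;> simp [inFst, Matrix.mul_apply, Fintype.sum_prod_type]

theorem inSnd_mul (U V : Matrix (Fin 2) (Fin 2) A) : inSnd (U * V) = inSnd U * inSnd V := by
  ext ⟨i, i'⟩ ⟨j, j'⟩
  fin_cases i <;> fin_cases j <;> simp [inSnd, Matrix.mul_apply, Fintype.sum_prod_type]

theorem inFst_mul_inSnd_comm {U V : Matrix (Fin 2) (Fin 2) A}
    (h : ∀ i j k l, Commute (U i j) (V k l)) : inFst U * inSnd V = inSnd V * inFst U := by
  ext ⟨i, i'⟩ ⟨j, j'⟩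
  simp [inFst, inSnd, Matrix.mul_apply, Fintype.sum_prod_type]
  exact h _ _ _ _

variable [Algebra ℂ A] [Algebra ℂ B]

/-- The scalar `R`-matrix acting on two auxiliary spaces. -/
def rAux (A : Type*) [Ring A] [Algebra ℂ A] (η u : ℂ) :
    Matrix (Fin 2 × Fin 2) (Fin 2 × Fin 2) A :=
  (rMatrix η u).map (algebraMap ℂ A)

theorem inFst_map (f : A →ₐ[ℂ] B) (U : Matrix (Fin 2) (Fin 2) A) :
    (inFst U).map f = inFst (U.map f) := by
  ext ⟨i, i'⟩ ⟨j, j'⟩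
  simp only [inFst, Matrix.map_apply, Matrix.of_apply, apply_ite f, map_zero]

theorem inSnd_map (f : A →ₐ[ℂ] B) (U : Matrix (Fin 2) (Fin 2) A) :
    (inSnd U).map f = inSnd (U.map f) := by
  ext ⟨i, i'⟩ ⟨j, j'⟩
  simp only [inSnd, Matrix.map_apply, Matrix.of_apply, apply_ite f, map_zero]

theorem rAux_map (f : A →ₐ[ℂ] B) (η u : ℂ) : (rAux A η u).map f = rAux B η u := by
  ext i j
  simp only [rAux, Matrix.map_apply, AlgHom.commutes]

/-- Reduces hyperbolic identities to rational ones in a few exponentials treated as independent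
variables. -/
theorem sinh_eq_of_exp_eq {u z : ℂ} (h : exp u = z) : sinh u = (z - z⁻¹) / 2 := by
  rw [sinh, exp_neg, h]

set_option maxHeartbeats 1000000 in
/-- The Yang–Baxter equation `R₁₂(u - v) R₁₃(u) R₂₃(v) = R₂₃(v) R₁₃(u) R₁₂(u - v)`. -/
theorem yangBaxter_sub (η u v : ℂ) :
    rAux _ η (u - v) * inFst (rBlock η u) * inSnd (rBlock η v) =
      inSnd (rBlock η v) * inFst (rBlock η u) * rAux _ η (u - v) := by
  have e1 := sinh_eq_of_exp_eq (u := u + η) (exp_add _ _)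
  have e2 := sinh_eq_of_exp_eq (u := u) rfl
  have e3 := sinh_eq_of_exp_eq (u := v + η) (exp_add _ _)
  have e4 := sinh_eq_of_exp_eq (u := v) rfl
  have e5 := sinh_eq_of_exp_eq (u := u - v + η) ((exp_add _ _).trans (by rw [exp_sub]))
  have e6 := sinh_eq_of_exp_eq (u := u - v) (exp_sub _ _)
  have e7 := sinh_eq_of_exp_eq (u := η) rfl
  have x1 := exp_ne_zero u
  have x2 := exp_ne_zero v
  have x3 := exp_ne_zero η
  ext ⟨i, i'⟩ ⟨j, j'⟩ a b
  fin_cases i <;> fin_cases i' <;> fin_cases j <;> fin_cases j' <;>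
    simp [Matrix.mul_apply, Fintype.sum_prod_type, rAux, inFst, inSnd,
      Algebra.algebraMap_eq_smul_one, rMatrix_entries] <;>
    fin_cases a <;> fin_cases b <;>
    simp [rBlock, -mul_eq_mul_left_iff, -mul_eq_mul_right_iff] <;>
    first
      | ring1
      | (simp only [e1, e2, e3, e4, e5, e6, e7]; field_simp; first | ring1 | (ring_nf; simp))

set_option maxHeartbeats 1000000 in
/-- The Yang–Baxter equation `R₁₃(u) R₁₂(u + v) R₂₃(v) = R₂₃(v) R₁₂(u + v) R₁₃(u)`. -/
theorem yangBaxter_add (η u v : ℂ) :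
    inFst (rBlock η u) * rAux _ η (u + v) * inSnd (rBlock η v) =
      inSnd (rBlock η v) * rAux _ η (u + v) * inFst (rBlock η u) := by
  have e1 := sinh_eq_of_exp_eq (u := u + η) (exp_add _ _)
  have e2 := sinh_eq_of_exp_eq (u := u) rfl
  have e3 := sinh_eq_of_exp_eq (u := v + η) (exp_add _ _)
  have e4 := sinh_eq_of_exp_eq (u := v) rfl
  have e5 := sinh_eq_of_exp_eq (u := u + v + η) ((exp_add _ _).trans (by rw [exp_add]))
  have e6 := sinh_eq_of_exp_eq (u := u + v) (exp_add _ _)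
  have e7 := sinh_eq_of_exp_eq (u := η) rfl
  have x1 := exp_ne_zero u
  have x2 := exp_ne_zero v
  have x3 := exp_ne_zero η
  ext ⟨i, i'⟩ ⟨j, j'⟩ a b
  fin_cases i <;> fin_cases i' <;> fin_cases j <;> fin_cases j' <;>
    simp [Matrix.mul_apply, Fintype.sum_prod_type, rAux, inFst, inSnd,
      Algebra.algebraMap_eq_smul_one, rMatrix_entries] <;>
    fin_cases a <;> fin_cases b <;>
    simp [rBlock, -mul_eq_mul_left_iff, -mul_eq_mul_right_iff] <;>
    first
      | ring1
      | (simp only [e1, e2, e3, e4, e5, e6, e7]; field_simp; first | ring1 | (ring_nf; simp))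

/-- The reflection equation for `U` at the (shifted) spectral parameter `x` and `V` at `y`. -/
def Reflection (η x y : ℂ) (U V : Matrix (Fin 2) (Fin 2) A) : Prop :=
  rAux A η (x - y) * inFst U * rAux A η (x + y) * inSnd V =
    inSnd V * rAux A η (x + y) * inFst U * rAux A η (x - y)

theorem reflection_map (f : A →ₐ[ℂ] B) {η x y : ℂ} {U V : Matrix (Fin 2) (Fin 2) A}
    (h : Reflection η x y U V) : Reflection η x y (U.map f) (V.map f) := by
  have := congrArg (fun M => M.map f) h
  simpa only [Reflection, Matrix.map_mul, rAux_map, inFst_map, inSnd_map] using this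

/-- Sklyanin's dressing: a solution `u` of the reflection equation stays one after multiplication by
`l` and `m`, which commute with `u` across the two auxiliary spaces and satisfy Yang–Baxter
relations with `r` and `s`. -/
theorem dressed_reflection {S : Type*} [Ring S] {r s l₁ u₁ m₁ l₂ u₂ m₂ : S}
    (hu : r * u₁ * s * u₂ = u₂ * s * u₁ * r)
    (hl : r * l₁ * l₂ = l₂ * l₁ * r) (hm : r * m₁ * m₂ = m₂ * m₁ * r)
    (hml : m₁ * s * l₂ = l₂ * s * m₁) (hlm : l₁ * s * m₂ = m₂ * s * l₁)
    (c₁ : u₁ * l₂ = l₂ * u₁) (c₂ : m₁ * u₂ = u₂ * m₁) (c₃ : l₁ * u₂ = u₂ * l₁)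
    (c₄ : u₁ * m₂ = m₂ * u₁) :
    r * (l₁ * u₁ * m₁) * s * (l₂ * u₂ * m₂) = l₂ * u₂ * m₂ * s * (l₁ * u₁ * m₁) * r := by
  calc r * (l₁ * u₁ * m₁) * s * (l₂ * u₂ * m₂)
      = r * l₁ * u₁ * (m₁ * s * l₂) * u₂ * m₂ := by simp only [mul_assoc]
    _ = r * l₁ * (u₁ * l₂) * s * (m₁ * u₂) * m₂ := by rw [hml]; simp only [mul_assoc]
    _ = (r * l₁ * l₂) * u₁ * s * u₂ * m₁ * m₂ := by rw [c₁, c₂]; simp only [mul_assoc]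
    _ = l₂ * l₁ * (r * u₁ * s * u₂) * m₁ * m₂ := by rw [hl]; simp only [mul_assoc]
    _ = l₂ * (l₁ * u₂) * s * u₁ * (r * m₁ * m₂) := by rw [hu]; simp only [mul_assoc]
    _ = l₂ * u₂ * l₁ * s * (u₁ * m₂) * m₁ * r := by rw [c₃, hm]; simp only [mul_assoc]
    _ = l₂ * u₂ * (l₁ * s * m₂) * u₁ * m₁ * r := by rw [c₄]; simp only [mul_assoc]
    _ = l₂ * u₂ * m₂ * s * (l₁ * u₁ * m₁) * r := by rw [hlm]; simp only [mul_assoc]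

end reflection

theorem uMinus_zero (P : Params 0) (l : ℂ) : P.uMinus l = onAux (P.kMinus l) := by
  have h : ∀ m, P.bulkM m = 1 := fun m => rfl
  simp only [Params.uMinus, Params.bulkMhat, h, Matrix.transpose_one, mul_one, one_mul, pow_zero,
    one_smul, onAux_sigmaY_mul_self]

set_option maxHeartbeats 1000000 in
/-- The reflection equation for the boundary matrix. -/
theorem kMinus_reflection {N : ℕ} (P : Params N) (l m : ℂ) :
    Reflection P.η (l - P.η / 2) (m - P.η / 2) (P.kMinus l) (P.kMinus m) := by
  have x1 := exp_ne_zero (l - P.η / 2)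
  have x2 := exp_ne_zero (m - P.η / 2)
  have x3 := exp_ne_zero P.η
  have x4 := exp_ne_zero P.ζ
  have x5 := exp_ne_zero P.τ
  have e1 := sinh_eq_of_exp_eq (u := l - P.η / 2 + P.ζ) (exp_add _ _)
  have e2 := sinh_eq_of_exp_eq (u := P.ζ - l + P.η / 2)
    (z := exp P.ζ / exp (l - P.η / 2)) (by rw [← exp_sub]; ring_nf)
  have e3 := sinh_eq_of_exp_eq (u := m - P.η / 2 + P.ζ) (exp_add _ _)
  have e4 := sinh_eq_of_exp_eq (u := P.ζ - m + P.η / 2)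
    (z := exp P.ζ / exp (m - P.η / 2)) (by rw [← exp_sub]; ring_nf)
  have e5 := sinh_eq_of_exp_eq (u := 2 * l - P.η)
    (z := exp (l - P.η / 2) * exp (l - P.η / 2)) (by rw [← exp_add]; ring_nf)
  have e6 := sinh_eq_of_exp_eq (u := 2 * m - P.η)
    (z := exp (m - P.η / 2) * exp (m - P.η / 2)) (by rw [← exp_add]; ring_nf)
  have e7 : exp (-P.τ) = (exp P.τ)⁻¹ := exp_neg _
  have f1 := sinh_eq_of_exp_eq (u := l - P.η / 2 - (m - P.η / 2)) (exp_sub _ _)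
  have f2 := sinh_eq_of_exp_eq (u := l - P.η / 2 - (m - P.η / 2) + P.η)
    ((exp_add _ _).trans (by rw [exp_sub]))
  have f3 := sinh_eq_of_exp_eq (u := l - P.η / 2 + (m - P.η / 2)) (exp_add _ _)
  have f4 := sinh_eq_of_exp_eq (u := l - P.η / 2 + (m - P.η / 2) + P.η)
    ((exp_add _ _).trans (by rw [exp_add]))
  have f5 := sinh_eq_of_exp_eq (u := P.η) rfl
  have hr : ∀ u, rAux ℂ P.η u = rMatrix P.η u := fun u => by ext; simp [rAux]
  unfold Reflection Params.kMinus
  generalize 1 / sinh P.ζ = s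
  simp only [hr]
  ext ⟨i, i'⟩ ⟨j, j'⟩
  fin_cases i <;> fin_cases i' <;> fin_cases j <;> fin_cases j' <;>
    simp [Matrix.mul_apply, Fintype.sum_prod_type, inFst, inSnd, rMatrix_entries,
      -mul_eq_mul_left_iff, -mul_eq_mul_right_iff, -sub_add_sub_cancel, -sub_sub_sub_cancel_right] <;>
    first
      | ring1
      | (simp only [e1, e2, e3, e4, e5, e6, e7, f1, f2, f3, f4, f5]; field_simp; ring1)

/-- With `x = l - η/2`, the two factors added by a site have arguments `x - ξ` and `x + ξ`. Like
factors differ by `x - y` and mixed ones sum to `x + y`, which is what the two Yang–Baxter equations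
require. -/
theorem uMinus_reflection {N : ℕ} (P : Params N) (l m : ℂ) :
    Reflection P.η (l - P.η / 2) (m - P.η / 2) (P.uMinus l) (P.uMinus m) := by
  induction N with
  | zero =>
    rw [uMinus_zero, uMinus_zero]
    exact reflection_map (Algebra.ofId ℂ (Op 0)) (kMinus_reflection P l m)
  | succ n ih =>
    have hu := reflection_map (liftHom n) (ih P.init)
    unfold Reflection at hu ⊢
    rw [uMinus_succ, uMinus_succ]
    simp only [inFst_mul, inSnd_mul]
    set ξ := P.ξ (Fin.last n)
    have hsub : ∀ u v w, w = u - v → rAux (Op (n + 1)) P.η w *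
        inFst ((rBlock P.η u).map (siteHom n)) * inSnd ((rBlock P.η v).map (siteHom n)) =
        inSnd ((rBlock P.η v).map (siteHom n)) * inFst ((rBlock P.η u).map (siteHom n)) *
          rAux (Op (n + 1)) P.η w := by
      rintro u v w rfl
      have := congrArg (fun M => M.map (siteHom n)) (yangBaxter_sub P.η u v)
      simpa only [Matrix.map_mul, rAux_map, inFst_map, inSnd_map] using this
    have hadd : ∀ u v w, w = u + v → inFst ((rBlock P.η u).map (siteHom n)) *
        rAux (Op (n + 1)) P.η w * inSnd ((rBlock P.η v).map (siteHom n)) =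
        inSnd ((rBlock P.η v).map (siteHom n)) * rAux (Op (n + 1)) P.η w *
          inFst ((rBlock P.η u).map (siteHom n)) := by
      rintro u v w rfl
      have := congrArg (fun M => M.map (siteHom n)) (yangBaxter_add P.η u v)
      simpa only [Matrix.map_mul, rAux_map, inFst_map, inSnd_map] using this
    have c1 : ∀ (U : AuxOp n) (V : Matrix (Fin 2) (Fin 2) (Matrix (Fin 2) (Fin 2) ℂ)), inFst (U.map (liftHom n)) * inSnd (V.map (siteHom n)) =
        inSnd (V.map (siteHom n)) * inFst (U.map (liftHom n)) := fun U V =>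
      inFst_mul_inSnd_comm fun i j k l => commute_lift_site _ _
    have c2 : ∀ (U : AuxOp n) (V : Matrix (Fin 2) (Fin 2) (Matrix (Fin 2) (Fin 2) ℂ)), inFst (V.map (siteHom n)) * inSnd (U.map (liftHom n)) =
        inSnd (U.map (liftHom n)) * inFst (V.map (siteHom n)) := fun U V =>
      inFst_mul_inSnd_comm fun i j k l => (commute_lift_site _ _).symm
    exact dressed_reflection hu (hsub _ _ _ (by ring)) (hsub _ _ _ (by ring))
      (hadd _ _ _ (by ring)) (hadd _ _ _ (by ring)) (c1 _ _) (c2 _ _) (c2 _ _) (c1 _ _)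

/-! ### Exchange relations of the gauged entries -/

section exchange

variable {A : Type*} [Ring A] [Algebra ℂ A]

/-- The entry `(1, -q/X) U (qX, 1)ᵗ` of a matrix `U`. -/
def bForm (q X : ℂ) (U : Matrix (Fin 2) (Fin 2) A) : A :=
  (q * X) • U 0 0 + U 0 1 - (q ^ 2) • U 1 0 - (q * X⁻¹) • U 1 1

/-- The entry `(0, 1) U (qX, 1)ᵗ` of a matrix `U`. -/
def dForm (q X : ℂ) (U : Matrix (Fin 2) (Fin 2) A) : A := (q * X) • U 1 0 + U 1 1

-- Only the shift `q ↦ q e^{2η}` and the first coefficient matter later: the last summand ends in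
-- `B_q(y)` and will act on vectors which that operator kills.
set_option maxHeartbeats 1000000 in
theorem bForm_mul_dForm {η x y : ℂ} {U V : Matrix (Fin 2) (Fin 2) A}
    (h : Reflection η x y U V) (q : ℂ) :
    (sinh (x - y) * sinh (x + y + η)) • (bForm q (exp x) U * dForm q (exp y) V) =
      (sinh (x - y + η) * sinh (x + y)) •
          (dForm (q * exp η ^ 2) (exp y) V * bForm q (exp x) U) +
        ((-(sinh η * sinh (x - y))) • U 0 0 +
          (q * sinh η / 2 * (-exp y * (exp x)⁻¹ ^ 2 + (1 + exp η ^ 2) * (exp y)⁻¹ -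
            exp η ^ 2 * exp x ^ 2 * exp y)) • U 1 0 +
          (-(sinh η * sinh (x + y))) • U 1 1) * bForm q (exp y) V := by
  have r := fun i i' j j' => congrFun (congrFun h (i, i')) (j, j')
  have r1 := r 0 1 0 0
  have r2 := r 0 1 0 1
  have r3 := r 0 1 1 0
  have r4 := r 0 1 1 1
  have r5 := r 1 1 0 0
  have r6 := r 1 1 0 1
  have r7 := r 1 1 1 0
  have r8 := r 1 1 1 1
  clear r h
  simp [Matrix.mul_apply, Fintype.sum_prod_type, inFst, inSnd, rAux, rMatrix_entries,
    Algebra.algebraMap_eq_smul_one, add_mul, smul_smul] at r1 r2 r3 r4 r5 r6 r7 r8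
  have e1 := sinh_eq_of_exp_eq (u := x - y) (exp_sub _ _)
  have e2 := sinh_eq_of_exp_eq (u := x - y + η) ((exp_add _ _).trans (by rw [exp_sub]))
  have e3 := sinh_eq_of_exp_eq (u := x + y) (exp_add _ _)
  have e4 := sinh_eq_of_exp_eq (u := x + y + η) ((exp_add _ _).trans (by rw [exp_add]))
  have e5 := sinh_eq_of_exp_eq (u := η) rfl
  have x1 := exp_ne_zero x
  have x2 := exp_ne_zero y
  have x3 := exp_ne_zero η
  -- With `t = e^η`, the reflection equation is contracted on the left with `(1, -qt/X) ⊗ (0, 1)`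
  -- and on the right with `(qtX, 1) ⊗ (qY, 1)`. The latter is chosen because `R(x - y)` maps it to
  -- `sinh(x - y + η) (qX, 1) ⊗ (qtY, 1)`.
  linear_combination (norm := skip) (q * exp x * exp η * (q * exp y)) • r1 +
    (q * exp x * exp η) • r2 + (q * exp y) • r3 + r4 -
    (q * exp η * (exp x)⁻¹) • ((q * exp x * exp η * (q * exp y)) • r5 +
    (q * exp x * exp η) • r6 + (q * exp y) • r7 + r8)
  simp only [bForm, dForm, add_mul, mul_add, mul_sub, sub_mul, smul_mul_assoc, mul_smul_comm]
  rw [e1, e2, e3, e4, e5]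
  generalize exp x = X at *
  generalize exp y = Y at *
  generalize exp η = t at *
  match_scalars <;> field_simp <;> ring

set_option maxHeartbeats 1000000 in
theorem dForm_mul_dForm {η x y : ℂ} {U V : Matrix (Fin 2) (Fin 2) A}
    (h : Reflection η x y U V) (q : ℂ) :
    (sinh (x - y + η) * sinh (x + y + η)) •
        (dForm q (exp x) U * dForm q (exp y) V - dForm q (exp y) V * dForm q (exp x) U) =
      (sinh η * sinh (x - y + η)) •
        (V 1 0 * bForm q (exp x) U - U 1 0 * bForm q (exp y) V) := by
  have r := fun j j' => congrFun (congrFun h (1, 1)) (j, j')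
  have r5 := r 0 0
  have r6 := r 0 1
  have r7 := r 1 0
  have r8 := r 1 1
  clear r h
  simp [Matrix.mul_apply, Fintype.sum_prod_type, inFst, inSnd, rAux, rMatrix_entries,
    Algebra.algebraMap_eq_smul_one, add_mul, smul_smul] at r5 r6 r7 r8
  have e1 := sinh_eq_of_exp_eq (u := x - y) (exp_sub _ _)
  have e2 := sinh_eq_of_exp_eq (u := x - y + η) ((exp_add _ _).trans (by rw [exp_sub]))
  have e3 := sinh_eq_of_exp_eq (u := x + y) (exp_add _ _)
  have e4 := sinh_eq_of_exp_eq (u := x + y + η) ((exp_add _ _).trans (by rw [exp_add]))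
  have e5 := sinh_eq_of_exp_eq (u := η) rfl
  have x1 := exp_ne_zero x
  have x2 := exp_ne_zero y
  have x3 := exp_ne_zero η
  -- Same right vector as for `bForm_mul_dForm`, now with `(0, 1) ⊗ (0, 1)` on the left.
  linear_combination (norm := skip) (q * exp x * exp η * (q * exp y)) • r5 +
    (q * exp x * exp η) • r6 + (q * exp y) • r7 + r8
  simp only [bForm, dForm, add_mul, mul_add, mul_sub, smul_mul_assoc, mul_smul_comm]
  rw [e1, e2, e3, e4, e5]
  generalize exp x = X at *
  generalize exp y = Y at *
  generalize exp η = t at *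
  match_scalars <;> field_simp <;> ring

end exchange

/-! ### Action on a tensor product with the last site -/

theorem bForm_mulVec {N : ℕ} (q X : ℂ) (U : AuxOp N) (ψ : State N) :
    (bForm q X U).mulVec ψ = (q * X) • (U 0 0).mulVec ψ + (U 0 1).mulVec ψ -
      (q ^ 2) • (U 1 0).mulVec ψ - (q * X⁻¹) • (U 1 1).mulVec ψ := by
  simp only [bForm, sub_mulVec, add_mulVec, smul_mulVec]

theorem dForm_mulVec {N : ℕ} (q X : ℂ) (U : AuxOp N) (ψ : State N) :
    (dForm q X U).mulVec ψ = (q * X) • (U 1 0).mulVec ψ + (U 1 1).mulVec ψ := by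
  simp only [dForm, add_mulVec, smul_mulVec]

namespace Params

/-- The gauge-transformed operator `ℬ₋`, up to normalization, at the gauge parameter `q`. -/
def bOp {N : ℕ} (P : Params N) (l q : ℂ) : Op N := bForm q (exp (l - P.η / 2)) (P.uMinus l)

/-- The analogue of `𝒟₋` in which only the right gauge vector is kept. -/
def dOp {N : ℕ} (P : Params N) (l q : ℂ) : Op N := dForm q (exp (l - P.η / 2)) (P.uMinus l)

end Params

theorem uMinus_mulVec_ten {n : ℕ} (P : Params (n + 1)) (l : ℂ) (i j : Fin 2) (ψ : State n)
    (v : Fin 2 → ℂ) : (P.uMinus l i j).mulVec (ten ψ v) =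
      ∑ b, ∑ a, ten ((P.init.uMinus l a b).mulVec ψ)
        ((rBlock P.η (l - P.ξ (Fin.last n) - P.η / 2) i a *
          rBlock P.η (l + P.ξ (Fin.last n) - P.η / 2) b j).mulVec v) := by
  simp only [uMinus_succ_apply, Matrix.sum_mulVec, kr_mulVec_ten]

-- The local vector is the one for which the diagonal and off-diagonal entries of the shorter chain
-- recombine into its own `bOp`. The gauge parameter drops by `e^η` on the shorter chain.
set_option maxHeartbeats 1000000 in
theorem bOp_mulVec_ten {n : ℕ} (P : Params (n + 1)) (l q : ℂ) (ψ : State n) :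
    (P.bOp l (q * exp P.η)).mulVec (ten ψ ![q * exp (-P.ξ (Fin.last n)), 1]) =
      (sinh (l + P.ξ (Fin.last n) + P.η / 2) * sinh (l - P.ξ (Fin.last n) - P.η / 2)) •
        ten ((P.init.bOp l q).mulVec ψ) ![q * exp P.η ^ 2 * exp (-P.ξ (Fin.last n)), 1] := by
  have hη : P.init.η = P.η := rfl
  simp only [Params.bOp, bForm_mulVec, uMinus_mulVec_ten, hη]
  generalize P.ξ (Fin.last n) = ξ
  have y1 : sinh (l + ξ + P.η / 2) = _ := sinh_eq_of_exp_eq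
    (show _ = exp (l - P.η / 2) * exp P.η / exp (-ξ) by
      rw [← exp_add, ← exp_sub]; ring_nf)
  have y2 : sinh (l - ξ - P.η / 2) = _ := sinh_eq_of_exp_eq
    (show _ = exp (l - P.η / 2) * exp (-ξ) by rw [← exp_add]; ring_nf)
  have y3 : sinh (l - ξ - P.η / 2 + P.η) = _ := sinh_eq_of_exp_eq
    (show _ = exp (l - P.η / 2) * exp P.η * exp (-ξ) by rw [← exp_add, ← exp_add]; ring_nf)
  have y4 : sinh (l + ξ - P.η / 2 + P.η) = _ := sinh_eq_of_exp_eq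
    (show _ = exp (l - P.η / 2) * exp P.η / exp (-ξ) by
      rw [← exp_add, ← exp_sub]; ring_nf)
  have y5 : sinh (l + ξ - P.η / 2) = _ := sinh_eq_of_exp_eq
    (show _ = exp (l - P.η / 2) / exp (-ξ) by rw [← exp_sub]; ring_nf)
  have y6 := sinh_eq_of_exp_eq (u := P.η) rfl
  have x1 := exp_ne_zero (l - P.η / 2)
  have x2 := exp_ne_zero (-ξ)
  have x3 := exp_ne_zero P.η
  ext h
  generalize (P.init.uMinus l) = U
  simp only [Fin.sum_univ_two, Pi.add_apply, Pi.sub_apply, Pi.smul_apply, smul_eq_mul, ten]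
  generalize (U 0 0).mulVec ψ (Fin.init h) = a
  generalize (U 0 1).mulVec ψ (Fin.init h) = b
  generalize (U 1 0).mulVec ψ (Fin.init h) = c
  generalize (U 1 1).mulVec ψ (Fin.init h) = d
  generalize h (Fin.last n) = k
  fin_cases k <;> simp [rBlock, -mul_eq_mul_left_iff, -mul_eq_mul_right_iff] <;>
    simp only [y1, y2, y3, y4, y5, y6] <;>
    generalize exp (l - P.η / 2) = X at * <;>
    generalize exp (-ξ) = z at * <;>
    generalize exp P.η = t at * <;>
    field_simp <;> ring

-- The local vector is preserved up to a term in the `bOp` of the shorter chain. That term vanishes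
-- at a site of the shorter chain not yet used, and at the last site it supplies the new direction
-- `(1, 0)`.
set_option maxHeartbeats 1000000 in
theorem dOp_mulVec_ten {n : ℕ} (P : Params (n + 1)) (l q : ℂ) (ψ : State n) :
    (P.dOp l (q * exp P.η)).mulVec (ten ψ ![q * exp (-P.ξ (Fin.last n)), 1]) =
      sinh (l + P.ξ (Fin.last n) + P.η / 2) •
        (sinh (l - P.ξ (Fin.last n) + P.η / 2) •
          ten ((P.init.dOp l q).mulVec ψ) ![q * exp (-P.ξ (Fin.last n)), 1] +
        sinh P.η • ten ((P.init.bOp l q).mulVec ψ) ![1, 0]) := by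
  have hη : P.init.η = P.η := rfl
  simp only [Params.bOp, Params.dOp, bForm_mulVec, dForm_mulVec, uMinus_mulVec_ten, hη]
  generalize P.ξ (Fin.last n) = ξ
  have y1 : sinh (l + ξ + P.η / 2) = _ := sinh_eq_of_exp_eq
    (show _ = exp (l - P.η / 2) * exp P.η / exp (-ξ) by
      rw [← exp_add, ← exp_sub]; ring_nf)
  have y2 : sinh (l - ξ - P.η / 2) = _ := sinh_eq_of_exp_eq
    (show _ = exp (l - P.η / 2) * exp (-ξ) by rw [← exp_add]; ring_nf)
  have y3 : sinh (l - ξ - P.η / 2 + P.η) = _ := sinh_eq_of_exp_eq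
    (show _ = exp (l - P.η / 2) * exp P.η * exp (-ξ) by rw [← exp_add, ← exp_add]; ring_nf)
  have y4 : sinh (l + ξ - P.η / 2 + P.η) = _ := sinh_eq_of_exp_eq
    (show _ = exp (l - P.η / 2) * exp P.η / exp (-ξ) by
      rw [← exp_add, ← exp_sub]; ring_nf)
  have y5 : sinh (l + ξ - P.η / 2) = _ := sinh_eq_of_exp_eq
    (show _ = exp (l - P.η / 2) / exp (-ξ) by rw [← exp_sub]; ring_nf)
  have y6 := sinh_eq_of_exp_eq (u := P.η) rfl
  have y7 : sinh (l - ξ + P.η / 2) = _ := sinh_eq_of_exp_eq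
    (show _ = exp (l - P.η / 2) * exp P.η * exp (-ξ) by rw [← exp_add, ← exp_add]; ring_nf)
  have x1 := exp_ne_zero (l - P.η / 2)
  have x2 := exp_ne_zero (-ξ)
  have x3 := exp_ne_zero P.η
  ext h
  generalize (P.init.uMinus l) = U
  simp only [Fin.sum_univ_two, Pi.add_apply, Pi.sub_apply, Pi.smul_apply, smul_eq_mul, ten]
  generalize (U 0 0).mulVec ψ (Fin.init h) = a
  generalize (U 0 1).mulVec ψ (Fin.init h) = b
  generalize (U 1 0).mulVec ψ (Fin.init h) = c
  generalize (U 1 1).mulVec ψ (Fin.init h) = d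
  generalize h (Fin.last n) = k
  fin_cases k <;> simp [rBlock, -mul_eq_mul_left_iff, -mul_eq_mul_right_iff] <;>
    simp only [y1, y2, y3, y4, y5, y6, y7] <;>
    generalize exp (l - P.η / 2) = X at * <;>
    generalize exp (-ξ) = z at * <;>
    generalize exp P.η = t at * <;>
    field_simp <;> ring

/-! ### The reference state -/

namespace Params

/-- The reference state at the gauge parameter `q`. -/
def refVec {N : ℕ} (P : Params N) (q : ℂ) : State N := fun h =>
  ∏ n : Fin N, (![q * exp (-(((N : ℂ) - (n : ℕ)) * P.η) - P.ξ n), 1] : Fin 2 → ℂ) (h n)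

/-- The boundary contribution to the pseudo-eigenvalues of `bOp`. -/
def bdryFactor {N : ℕ} (P : Params N) (q : ℂ) : ℂ :=
  q * exp P.ζ + P.κ * exp P.τ - q ^ 2 * (P.κ * exp (-P.τ))

/-- The `h`-independent part of the pseudo-eigenvalues of `bOp`. -/
def bConst {N : ℕ} (P : Params N) (l q : ℂ) : ℂ :=
  (-1) ^ N * (sinh (2 * l - P.η) / sinh P.ζ * P.bdryFactor (q * exp (-(N * P.η))))

/-- The state obtained from the reference state by acting with `dOp` at the sites in `L`. -/
def phi {N : ℕ} (P : Params N) (L : List (Fin N)) (q : ℂ) : State N :=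
  (L.map fun n => P.dOp (P.ξ n + P.η / 2) q).prod.mulVec (P.refVec q)

end Params

/-- The label `h` with `h n = 0` exactly for the sites `n` in `L`. -/
def occ {N : ℕ} (L : List (Fin N)) : Fin N → Fin 2 := fun n => if n ∈ L then 0 else 1

theorem refVec_succ {n : ℕ} (P : Params (n + 1)) (q : ℂ) :
    P.refVec (q * exp P.η) = ten (P.init.refVec q) ![q * exp (-P.ξ (Fin.last n)), 1] := by
  ext h
  simp only [Params.refVec, ten, Fin.prod_univ_castSucc]
  congr 1
  · refine Finset.prod_congr rfl fun a _ => ?_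
    have : q * exp P.η * exp (-(((n + 1 : ℕ) - (a : ℕ) : ℂ) * P.η) - P.ξ a.castSucc) =
        q * exp (-(((n : ℂ) - (a : ℕ)) * P.η) - P.ξ a.castSucc) := by
      rw [mul_assoc, ← exp_add]; push_cast; ring_nf
    simp only [Fin.val_castSucc, this]
    rfl
  · have : q * exp P.η * exp (-(((n + 1 : ℕ) - (n : ℕ) : ℂ) * P.η) - P.ξ (Fin.last n)) =
        q * exp (-P.ξ (Fin.last n)) := by
      rw [mul_assoc, ← exp_add]; push_cast; ring_nf
    simp only [Fin.val_last, this]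

theorem bOp_mulVec_refVec {N : ℕ} (P : Params N) (l q : ℂ) :
    (P.bOp l q).mulVec (P.refVec q) =
      (P.bConst l q * (P.fnAh 1 l * P.fnAh 1 (-l))) • P.refVec (q * exp P.η ^ 2) := by
  induction N generalizing q with
  | zero =>
    ext h
    have x1 := exp_ne_zero (l - P.η / 2)
    have e1 := sinh_eq_of_exp_eq (u := l - P.η / 2 + P.ζ) (exp_add _ _)
    have e2 := sinh_eq_of_exp_eq (u := P.ζ - l + P.η / 2)
      (z := exp P.ζ / exp (l - P.η / 2)) (by rw [← exp_sub]; ring_nf)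
    have e5 := sinh_eq_of_exp_eq (u := 2 * l - P.η)
      (z := exp (l - P.η / 2) * exp (l - P.η / 2)) (by rw [← exp_add]; ring_nf)
    have x2 := exp_ne_zero P.ζ
    have x3 := exp_ne_zero P.τ
    simp only [Params.bOp, bForm_mulVec, uMinus_zero, onAux, Matrix.map_apply,
      Algebra.algebraMap_eq_smul_one, smul_mulVec, one_mulVec, Params.refVec, Params.bConst,
      Params.fnAh, Params.bdryFactor, Params.kMinus, Pi.add_apply, Pi.sub_apply, Pi.smul_apply,
      Finset.univ_eq_empty, Finset.prod_empty, smul_eq_mul, Matrix.smul_apply, pow_zero,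
      Matrix.of_apply, Matrix.cons_val', Matrix.cons_val_zero, Matrix.cons_val_one,
      Matrix.cons_val_fin_one, Nat.cast_zero, zero_mul, neg_zero, exp_zero, mul_one, one_mul]
    rw [e1, e2, e5]
    generalize (sinh P.ζ) = s
    generalize exp (l - P.η / 2) = X at *
    field_simp
    ring
  | succ n ih =>
    obtain ⟨q, rfl⟩ : ∃ q', q = q' * exp P.η := ⟨q / exp P.η, by field_simp⟩
    rw [refVec_succ, bOp_mulVec_ten, ih, show q * exp P.η * exp P.η ^ 2 =
      q * exp P.η ^ 2 * exp P.η by ring, refVec_succ, ten_smul_left, smul_smul]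
    congr 1
    have h1 : P.init.bdryFactor (q * exp (-(n * P.init.η))) =
        P.bdryFactor (q * exp P.η * exp (-((n + 1 : ℕ) * P.η))) := by
      have : q * exp P.η * exp (-((n + 1 : ℕ) * P.η)) = q * exp (-(n * P.η)) := by
        rw [mul_assoc, ← exp_add]; push_cast; ring_nf
      rw [this]; rfl
    have h2 : ∀ l, P.fnAh 1 l = P.init.fnAh 1 l * sinh (l - P.ξ (Fin.last n) - P.η / 2) := by
      intro l
      simp only [Params.fnAh, Fin.prod_univ_castSucc]
      congr 1
      congr 1
      simp
      ring
    have h3 : sinh (-l - P.ξ (Fin.last n) - P.η / 2) =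
        -sinh (l + P.ξ (Fin.last n) + P.η / 2) := by
      rw [← sinh_neg]; ring_nf
    simp only [Params.bConst, ← h1, h2, h3, pow_succ]
    simp only [Params.init]
    ring

/-! ### Continuity in the spectral parameter -/

theorem continuous_uMinus_apply {N : ℕ} (P : Params N) (i j : Fin 2) (h k : Fin N → Fin 2) :
    Continuous fun l => P.uMinus l i j h k := by
  induction N generalizing i j with
  | zero =>
    simp only [uMinus_zero, onAux, Matrix.map_apply, Matrix.algebraMap_matrix_apply,
      Params.kMinus]
    fin_cases i <;> fin_cases j <;> simp <;> split_ifs <;> fun_prop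
  | succ n ih =>
    have hR : ∀ (c : ℂ) (i j a b : Fin 2), Continuous fun l => rBlock P.η (l + c) i j a b := by
      intro c i j a b
      fin_cases i <;> fin_cases j <;> fin_cases a <;> fin_cases b <;> simp [rBlock] <;> fun_prop
    have h1 : ∀ l : ℂ, l - P.ξ (Fin.last n) - P.η / 2 = l + (- P.ξ (Fin.last n) - P.η / 2) := by
      intro l; ring
    have h2 : ∀ l : ℂ, l + P.ξ (Fin.last n) - P.η / 2 = l + (P.ξ (Fin.last n) - P.η / 2) := by
      intro l; ring
    simp only [uMinus_succ_apply, Matrix.sum_apply, kr, Matrix.of_apply, Matrix.mul_apply, h1, h2]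
    refine continuous_finsetSum _ fun b _ => continuous_finsetSum _ fun a _ => ?_
    exact (ih P.init _ _ _ _).mul (continuous_finsetSum _ fun c _ => (hR _ _ _ _ _).mul (hR _ _ _ _ _))

theorem continuous_bOp_mulVec_apply {N : ℕ} (P : Params N) (q : ℂ) (ψ : State N)
    (h : Fin N → Fin 2) : Continuous fun l => (P.bOp l q).mulVec ψ h := by
  have hU : ∀ i j, Continuous fun l => (P.uMinus l i j).mulVec ψ h := fun i j =>
    continuous_finsetSum _ fun k _ => (continuous_uMinus_apply P i j h k).mul continuous_const
  have hX : Continuous fun l => exp (l - P.η / 2) := by fun_prop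
  have hX' : Continuous fun l => (exp (l - P.η / 2))⁻¹ := hX.inv₀ fun _ => exp_ne_zero _
  simp only [Params.bOp, bForm_mulVec, Pi.add_apply, Pi.sub_apply, Pi.smul_apply, smul_eq_mul]
  exact ((((hX.const_mul q).mul (hU 0 0)).add (hU 0 1)).sub ((hU 1 0).const_mul _)).sub
    ((hX'.const_mul q).mul (hU 1 1))

theorem countable_sinh_eq_zero : {z : ℂ | sinh z = 0}.Countable := by
  refine (Set.countable_range fun n : ℤ => (n * Real.pi * I : ℂ)).mono fun z hz => ?_
  have h1 : sin (z * I) = 0 := by rw [sin_mul_I, hz, zero_mul]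
  obtain ⟨k, hk⟩ := sin_eq_zero_iff.1 h1
  refine ⟨-k, ?_⟩
  have : z = -(z * I) * I := by ring_nf; simp
  rw [this, hk]
  push_cast
  ring

theorem dense_sinh_mul_sinh_ne_zero (a b : ℂ) :
    Dense {l : ℂ | sinh (l - a) * sinh (l - b) ≠ 0} := by
  have h : ∀ c : ℂ, {l : ℂ | sinh (l - c) = 0}.Countable := fun c =>
    countable_sinh_eq_zero.preimage_of_injOn (f := fun l => l - c)
      (sub_left_injective.injOn)
  have := ((h a).union (h b)).dense_compl ℂ
  refine this.mono fun l hl => ?_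
  simpa [not_or] using hl

/-! ### Pseudo-eigenvectors generated from the reference state -/

section sov

variable {N : ℕ} (P : Params N)

theorem phi_nil (q : ℂ) : P.phi [] q = P.refVec q := by simp [Params.phi]

theorem phi_cons (n : Fin N) (L : List (Fin N)) (q : ℂ) :
    P.phi (n :: L) q = (P.dOp (P.ξ n + P.η / 2) q).mulVec (P.phi L q) := by
  simp [Params.phi, Matrix.mulVec_mulVec]

theorem occ_cons (n : Fin N) (L : List (Fin N)) : occ (n :: L) = Function.update (occ L) n 0 := by
  funext m
  by_cases h : m = n
  · subst h; simp [occ]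
  · simp [occ, h]

theorem fnAh_cons {n : Fin N} {L : List (Fin N)} (hn : n ∉ L) (l : ℂ) :
    P.fnAh (occ (n :: L)) l * sinh (l - P.ξ n - P.η / 2) =
      P.fnAh (occ L) l * sinh (l - P.ξ n + P.η / 2) := by
  have h : ∀ g : Fin N → Fin 2, P.fnAh g l = sinh (l - P.ξ n - (((g n : ℕ) : ℂ) - 1 / 2) * P.η) *
      ∏ m ∈ Finset.univ.erase n, sinh (l - P.ξ m - (((g m : ℕ) : ℂ) - 1 / 2) * P.η) := fun g =>
    (Finset.mul_prod_erase _ _ (Finset.mem_univ n)).symm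
  have h2 : ∏ m ∈ Finset.univ.erase n,
        sinh (l - P.ξ m - (((occ (n :: L) m : ℕ) : ℂ) - 1 / 2) * P.η) =
      ∏ m ∈ Finset.univ.erase n, sinh (l - P.ξ m - (((occ L m : ℕ) : ℂ) - 1 / 2) * P.η) := by
    refine Finset.prod_congr rfl fun m hm => ?_
    rw [occ_cons, Function.update_of_ne (Finset.ne_of_mem_erase hm)]
  rw [h, h (occ L), h2]
  have e1 : occ (n :: L) n = 0 := by simp [occ]
  have e2 : occ L n = 1 := by simp [occ, hn]
  rw [e1, e2, show l - P.ξ n - (((0 : Fin 2) : ℕ) - 1 / 2 : ℂ) * P.η = l - P.ξ n + P.η / 2 by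
    simp; ring, show l - P.ξ n - (((1 : Fin 2) : ℕ) - 1 / 2 : ℂ) * P.η = l - P.ξ n - P.η / 2 by
    simp; ring]
  ring

theorem fnAh_occ_eq_zero {n : Fin N} {L : List (Fin N)} (hn : n ∉ L) :
    P.fnAh (occ L) (P.ξ n + P.η / 2) = 0 := by
  refine Finset.prod_eq_zero (Finset.mem_univ n) ?_
  rw [show P.ξ n + P.η / 2 - P.ξ n - (((occ L n : Fin 2) : ℕ) - 1 / 2 : ℂ) * P.η = 0 by
    simp [occ, hn]; ring, sinh_zero]

theorem bOp_mulVec_dOp_mulVec (n : Fin N) (l q : ℂ) (ψ : State N)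
    (hψ : (P.bOp (P.ξ n + P.η / 2) q).mulVec ψ = 0) :
    (sinh (l - P.ξ n - P.η / 2) * sinh (l + P.ξ n + P.η / 2)) •
        (P.bOp l q).mulVec ((P.dOp (P.ξ n + P.η / 2) q).mulVec ψ) =
      (sinh (l - P.ξ n + P.η / 2) * sinh (l + P.ξ n - P.η / 2)) •
        (P.dOp (P.ξ n + P.η / 2) (q * exp P.η ^ 2)).mulVec ((P.bOp l q).mulVec ψ) := by
  have h := congrArg (fun X => X.mulVec ψ)
    (bForm_mul_dForm (uMinus_reflection P l (P.ξ n + P.η / 2)) q)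
  simp only [Params.bOp, Params.dOp] at hψ ⊢
  simp only [add_mulVec, smul_mulVec, ← mulVec_mulVec, hψ, mulVec_zero, add_zero] at h
  convert h using 3 <;> ring_nf

/-- Both correction terms of `dForm_mul_dForm` kill `ψ`; non-resonance with `r = 1` allows division
by the scalar prefactor. -/
theorem dOp_mulVec_dOp_mulVec_comm (hξ : P.NonResonant) {m n : Fin N} (hmn : m ≠ n) (q : ℂ)
    (ψ : State N) (hm : (P.bOp (P.ξ m + P.η / 2) q).mulVec ψ = 0)
    (hn : (P.bOp (P.ξ n + P.η / 2) q).mulVec ψ = 0) :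
    (P.dOp (P.ξ m + P.η / 2) q).mulVec ((P.dOp (P.ξ n + P.η / 2) q).mulVec ψ) =
      (P.dOp (P.ξ n + P.η / 2) q).mulVec ((P.dOp (P.ξ m + P.η / 2) q).mulVec ψ) := by
  have h := congrArg (fun X => X.mulVec ψ)
    (dForm_mul_dForm (uMinus_reflection P (P.ξ m + P.η / 2) (P.ξ n + P.η / 2)) q)
  simp only [Params.bOp, Params.dOp] at hm hn ⊢
  simp only [sub_mulVec, smul_mulVec, ← mulVec_mulVec, hm, hn, mulVec_zero, sub_zero,
    smul_zero] at h
  have h1 := (hξ 1 (by simp)).1 m n hmn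
  have h2 := (hξ 1 (by simp)).2 m n
  refine sub_eq_zero.1 ((smul_eq_zero.1 h).resolve_left (mul_ne_zero ?_ ?_))
  · convert h1 using 2; push_cast; ring
  · convert h2 using 2; push_cast; ring

theorem bOp_mulVec_phi {L : List (Fin N)} (hL : L.Nodup) (l q : ℂ) :
    (P.bOp l q).mulVec (P.phi L q) =
      (P.bConst l q * (P.fnAh (occ L) l * P.fnAh (occ L) (-l))) • P.phi L (q * exp P.η ^ 2) := by
  induction L generalizing l with
  | nil =>
    rw [phi_nil, phi_nil, bOp_mulVec_refVec, show (1 : Fin N → Fin 2) = occ [] by ext; simp [occ]]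
  | cons n L ih =>
    obtain ⟨hn, hL'⟩ := List.nodup_cons.1 hL
    have key := fun l => bOp_mulVec_dOp_mulVec P n l q (P.phi L q) (by
      rw [ih hL', fnAh_occ_eq_zero P hn]; simp)
    ext h
    -- `key` determines the action only where its left coefficient is nonzero. This set of `l` is
    -- dense and both sides are continuous in `l`, so the exceptional points follow.
    have hd := (dense_sinh_mul_sinh_ne_zero (P.ξ n + P.η / 2) (-(P.ξ n + P.η / 2)))
    have hc1 : Continuous fun l => (P.bOp l q).mulVec (P.phi (n :: L) q) h :=
      continuous_bOp_mulVec_apply P q _ h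
    have hc2 : Continuous fun l => ((P.bConst l q * (P.fnAh (occ (n :: L)) l *
        P.fnAh (occ (n :: L)) (-l))) • P.phi (n :: L) (q * exp P.η ^ 2)) h := by
      simp only [Pi.smul_apply, smul_eq_mul, Params.bConst, Params.fnAh]
      fun_prop
    refine congrFun (Continuous.ext_on hd hc1 hc2 fun l hl => ?_) l
    refine congrFun (?_ : (P.bOp l q).mulVec (P.phi (n :: L) q) = _) h
    refine smul_right_injective _ hl ?_
    have k := key l
    rw [ih hL', mulVec_smul, ← phi_cons, ← phi_cons, smul_smul] at k
    have f1 := fnAh_cons P hn l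
    have f2 := fnAh_cons P hn (-l)
    rw [show -l - P.ξ n - P.η / 2 = -(l + P.ξ n + P.η / 2) by ring,
      show -l - P.ξ n + P.η / 2 = -(l + P.ξ n - P.η / 2) by ring, sinh_neg, sinh_neg] at f2
    simp only [show l - (P.ξ n + P.η / 2) = l - P.ξ n - P.η / 2 by ring,
      show l - -(P.ξ n + P.η / 2) = l + P.ξ n + P.η / 2 by ring]
    rw [k, smul_smul]
    congr 1
    linear_combination (P.bConst l q * P.fnAh (occ L) l * sinh (l - P.ξ n + P.η / 2)) * f2 +
      (P.bConst l q * P.fnAh (occ (n :: L)) (-l) * sinh (l + P.ξ n + P.η / 2)) * (-f1)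

theorem bOp_mulVec_phi_eq_zero {L : List (Fin N)} (hL : L.Nodup) {n : Fin N} (hn : n ∉ L)
    (q : ℂ) : (P.bOp (P.ξ n + P.η / 2) q).mulVec (P.phi L q) = 0 := by
  rw [bOp_mulVec_phi P hL, fnAh_occ_eq_zero P hn]; simp

/-- An adjacent transposition suffices: neither of the two sites occurs in the tail, so both `bOp`s
kill the state to its right. -/
theorem phi_perm (hξ : P.NonResonant) {L L' : List (Fin N)} (h : L.Perm L') (hL : L.Nodup)
    (q : ℂ) : P.phi L q = P.phi L' q := by
  induction h with
  | nil => rfl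
  | cons n _ ih => rw [phi_cons, phi_cons, ih (List.nodup_cons.1 hL).2]
  | swap a b L =>
    simp only [List.nodup_cons, List.mem_cons, not_or] at hL
    obtain ⟨⟨hab, hb⟩, ha, hL⟩ := hL
    simp only [phi_cons]
    exact dOp_mulVec_dOp_mulVec_comm P hξ hab q _ (bOp_mulVec_phi_eq_zero P hL hb q)
      (bOp_mulVec_phi_eq_zero P hL ha q)
  | trans h1 _ ih1 ih2 => exact (ih1 hL).trans (ih2 (h1.nodup hL))

end sov

/-! ### Completeness by induction on the number of sites -/

/-- `ψ ↦ ψ ⊗ v` as a linear map. -/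
def tenLin {n : ℕ} (v : Fin 2 → ℂ) : State n →ₗ[ℂ] State (n + 1) where
  toFun ψ := ten ψ v
  map_add' ψ ψ' := ten_add_left ψ ψ' v
  map_smul' c ψ := ten_smul_left c ψ v

theorem nonResonant_init {n : ℕ} {P : Params (n + 1)} (h : P.NonResonant) :
    P.init.NonResonant := fun r hr =>
  ⟨fun a b hab => (h r hr).1 a.castSucc b.castSucc fun e => hab (Fin.castSucc_injective _ e),
    fun a b => (h r hr).2 a.castSucc b.castSucc⟩

theorem exists_phi_map_castSucc {n : ℕ} (P : Params (n + 1)) (hξ : P.NonResonant) (q : ℂ)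
    {L : List (Fin n)} (hL : L.Nodup) :
    ∃ c : ℂ, c ≠ 0 ∧ P.phi (L.map Fin.castSucc) (q * exp P.η) =
      c • ten (P.init.phi L q) ![q * exp (-P.ξ (Fin.last n)), 1] := by
  induction L with
  | nil => exact ⟨1, one_ne_zero, by rw [List.map_nil, phi_nil, phi_nil, refVec_succ, one_smul]⟩
  | cons a L ih =>
    obtain ⟨ha, hL⟩ := List.nodup_cons.1 hL
    obtain ⟨c, hc, h⟩ := ih hL
    have h0 : (P.init.bOp (P.ξ a.castSucc + P.η / 2) q).mulVec (P.init.phi L q) = 0 :=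
      bOp_mulVec_phi_eq_zero P.init hL ha q
    have h1 : P.init.phi (a :: L) q =
        (P.init.dOp (P.ξ a.castSucc + P.η / 2) q).mulVec (P.init.phi L q) :=
      phi_cons P.init a L q
    have s1 := (hξ 1 (by simp)).1 _ _ (Fin.castSucc_lt_last a).ne
    have s2 := (hξ 1 (by simp)).2 a.castSucc (Fin.last n)
    refine ⟨c * (sinh (P.ξ a.castSucc + P.ξ (Fin.last n) + (1 : ℤ) * P.η) *
      sinh (P.ξ a.castSucc - P.ξ (Fin.last n) + (1 : ℤ) * P.η)), mul_ne_zero hc (mul_ne_zero s2 s1), ?_⟩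
    rw [List.map_cons, phi_cons, h, mulVec_smul, dOp_mulVec_ten, h0, h1,
      show ten (0 : State n) ![1, 0] = 0 from (tenLin _).map_zero, smul_zero, add_zero,
      smul_smul, smul_smul]
    congr 1
    push_cast
    ring_nf

/-- The component along `(1, 0)` is explicit because it comes from `bOp` on the shorter chain,
evaluated by `bOp_mulVec_phi`; the other component `φ` is irrelevant. -/
theorem phi_last_cons {n : ℕ} (P : Params (n + 1)) (q : ℂ) {L : List (Fin n)} (hL : L.Nodup)
    {c : ℂ} (h : P.phi (L.map Fin.castSucc) (q * exp P.η) =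
      c • ten (P.init.phi L q) ![q * exp (-P.ξ (Fin.last n)), 1]) :
    ∃ φ, P.phi (Fin.last n :: L.map Fin.castSucc) (q * exp P.η) =
      ten φ ![q * exp (-P.ξ (Fin.last n)), 1] +
        (c * sinh (2 * P.ξ (Fin.last n) + P.η) * sinh P.η *
          (P.init.bConst (P.ξ (Fin.last n) + P.η / 2) q *
            (P.init.fnAh (occ L) (P.ξ (Fin.last n) + P.η / 2) *
              P.init.fnAh (occ L) (-(P.ξ (Fin.last n) + P.η / 2))))) •
        ten (P.init.phi L (q * exp P.η ^ 2)) ![1, 0] := by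
  have hη : P.init.η = P.η := rfl
  rw [phi_cons, h, mulVec_smul, dOp_mulVec_ten, bOp_mulVec_phi P.init hL, hη]
  refine ⟨(c * sinh (2 * P.ξ (Fin.last n) + P.η) * sinh P.η) •
    (P.init.dOp (P.ξ (Fin.last n) + P.η / 2) q).mulVec (P.init.phi L q), ?_⟩
  simp only [ten_smul_left, smul_add, smul_smul]
  congr 2 <;> ring_nf

theorem fnAh_last_ne_zero {n : ℕ} (P : Params (n + 1)) (hξ : P.NonResonant)
    (h : Fin n → Fin 2) : P.init.fnAh h (P.ξ (Fin.last n) + P.η / 2) ≠ 0 ∧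
      P.init.fnAh h (-(P.ξ (Fin.last n) + P.η / 2)) ≠ 0 := by
  have hη : P.init.η = P.η := rfl
  have hξ' : ∀ a, P.init.ξ a = P.ξ a.castSucc := fun _ => rfl
  have h01 : ∀ a, h a = 0 ∨ h a = 1 := fun a => by
    generalize h a = x; fin_cases x <;> simp
  constructor
  · refine Finset.prod_ne_zero_iff.2 fun a _ => ?_
    have h0 := (hξ 0 (by simp)).1 _ _ (Fin.castSucc_lt_last a).ne'
    have h1 := (hξ 1 (by simp)).1 _ _ (Fin.castSucc_lt_last a).ne'
    rcases h01 a with e | e <;> rw [e, hη, hξ']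
    · convert h1 using 2; simp; ring
    · convert h0 using 2; simp; ring
  · refine Finset.prod_ne_zero_iff.2 fun a _ => ?_
    have h0 := (hξ 0 (by simp)).2 a.castSucc (Fin.last n)
    have h1 := (hξ 1 (by simp)).2 a.castSucc (Fin.last n)
    rw [← neg_ne_zero, ← sinh_neg]
    rcases h01 a with e | e <;> rw [e, hη, hξ']
    · convert h0 using 2; simp; ring
    · convert h1 using 2; simp; ring

/-- The induction uses the shorter chain at `q` (`j < n`) and at `q e^{2η}` (`1 ≤ j ≤ n`), while the
factor at `j = 0` makes the coefficient in `phi_last_cons` nonzero. `sinh η ≠ 0` is demanded only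
for a nonempty chain, the only case in which `sinh_eta_ne_zero` can supply it. -/
theorem span_phi_eq_top {N : ℕ} (P : Params N) (hξ : P.NonResonant) (hη : 0 < N → sinh P.η ≠ 0)
    (hζ : sinh P.ζ ≠ 0) (q : ℂ)
    (hB : ∀ j < N, P.bdryFactor (q * exp (-(N * P.η)) * exp P.η ^ (2 * j)) ≠ 0) :
    Submodule.span ℂ {ψ | ∃ L : List (Fin N), L.Nodup ∧ ψ = P.phi L q} = ⊤ := by
  induction N generalizing q with
  | zero =>
    refine eq_top_iff.2 fun ψ _ => ?_
    have : ψ = ψ default • P.phi [] q := by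
      ext h
      simp [phi_nil, Params.refVec, Subsingleton.elim h default]
    rw [this]
    exact Submodule.smul_mem _ _ (Submodule.subset_span ⟨[], List.nodup_nil, rfl⟩)
  | succ n ih =>
    obtain ⟨q, rfl⟩ : ∃ q', q = q' * exp P.η := ⟨q / exp P.η, by field_simp⟩
    have hq : q * exp P.η * exp (-((n + 1 : ℕ) * P.η)) = q * exp (-(n * P.η)) := by
      rw [mul_assoc, ← exp_add]; push_cast; ring_nf
    rw [hq] at hB
    have hB' : ∀ j < n + 1, P.init.bdryFactor (q * exp (-(n * P.init.η)) *
      exp P.init.η ^ (2 * j)) ≠ 0 := hB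
    have ih1 := ih P.init (nonResonant_init hξ) (fun _ => hη n.succ_pos) hζ q fun j hj => hB' j (by omega)
    have ih2 := ih P.init (nonResonant_init hξ) (fun _ => hη n.succ_pos) hζ (q * exp P.η ^ 2) fun j hj => by
      convert hB' (j + 1) (by omega) using 2
      simp only [show P.init.η = P.η from rfl]
      ring
    set W := Submodule.span ℂ {ψ | ∃ L : List (Fin (n + 1)), L.Nodup ∧
      ψ = P.phi L (q * exp P.η)} with hW
    have m1 : ∀ ψ : State n, ten ψ ![q * exp (-P.ξ (Fin.last n)), 1] ∈ W := by
      have : (⊤ : Submodule ℂ (State n)) ≤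
          W.comap (tenLin ![q * exp (-P.ξ (Fin.last n)), 1]) := by
        rw [← ih1, Submodule.span_le]
        rintro _ ⟨L, hL, rfl⟩
        obtain ⟨c, hc, h⟩ := exists_phi_map_castSucc P hξ q hL
        have : P.phi (L.map Fin.castSucc) (q * exp P.η) ∈ W :=
          Submodule.subset_span ⟨_, hL.map (Fin.castSucc_injective n), rfl⟩
        rw [h, Submodule.smul_mem_iff W hc] at this
        exact this
      exact fun ψ => this trivial
    have m2 : ∀ ψ : State n, ten ψ ![1, 0] ∈ W := by
      have : (⊤ : Submodule ℂ (State n)) ≤ W.comap (tenLin ![1, 0]) := by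
        rw [← ih2, Submodule.span_le]
        rintro _ ⟨L, hL, rfl⟩
        obtain ⟨c, hc, h⟩ := exists_phi_map_castSucc P hξ q hL
        obtain ⟨φ, hφ⟩ := phi_last_cons P q hL h
        have hmem : P.phi (Fin.last n :: L.map Fin.castSucc) (q * exp P.η) ∈ W := by
          refine Submodule.subset_span ⟨_, List.nodup_cons.2
            ⟨fun hl => ?_, hL.map (Fin.castSucc_injective n)⟩, rfl⟩
          obtain ⟨a, -, ha⟩ := List.mem_map.1 hl
          exact (Fin.castSucc_lt_last a).ne ha
        rw [hφ] at hmem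
        rw [Submodule.add_mem_iff_right W (m1 φ), Submodule.smul_mem_iff W] at hmem
        · exact hmem
        have s1 := (hξ 1 (by simp)).2 (Fin.last n) (Fin.last n)
        have s0 := (hξ 0 (by simp)).2 (Fin.last n) (Fin.last n)
        have s2 := fnAh_last_ne_zero P hξ (occ L)
        have b0 := hB' 0 (by omega)
        refine mul_ne_zero (mul_ne_zero (mul_ne_zero hc ?_) (hη n.succ_pos))
          (mul_ne_zero (mul_ne_zero (by simp) (mul_ne_zero (div_ne_zero ?_ hζ) ?_))
            (mul_ne_zero s2.1 s2.2))
        · convert s1 using 2; push_cast; ring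
        · convert s0 using 2
          simp only [show P.init.η = P.η from rfl]
          push_cast; ring
        · simpa using b0
      exact fun ψ => this trivial
    refine eq_top_iff.2 fun ψ _ => ?_
    -- Each `ψ` is expanded at the last site in the basis `(q e^{-ξ}, 1)`, `(1, 0)` of `ℂ²`.
    have : ψ = ten (fun g => ψ (Fin.snoc (α := fun _ => Fin 2) g 1))
          ![q * exp (-P.ξ (Fin.last n)), 1] +
        ten (fun g => ψ (Fin.snoc (α := fun _ => Fin 2) g 0) - q * exp (-P.ξ (Fin.last n)) *
          ψ (Fin.snoc (α := fun _ => Fin 2) g 1)) ![1, 0] := by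
      ext h
      obtain ⟨g, k, rfl⟩ : ∃ (g : Fin n → Fin 2) (k : Fin 2),
          h = Fin.snoc (α := fun _ => Fin 2) g k := ⟨_, _, (Fin.snoc_init_self h).symm⟩
      simp only [Pi.add_apply, ten, Fin.init_snoc, Fin.snoc_last]
      fin_cases k
      · simp
        ring
      · simp
    rw [this]
    exact W.add_mem (m1 _) (m2 _)

/-! ### Return to the gauge-transformed operators and the SOV states -/

namespace Params

variable {N : ℕ} (P : Params N)

/-- The exponential `q` of the gauge parameter `β` that enters the second gauge vector. -/
def gaugeQ (β : ℂ) : ℂ := exp (-((P.α - β + 1) * P.η))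

/-- The exponential of the gauge parameter `β` that enters the first gauge vector. -/
def gaugeP (β : ℂ) : ℂ := exp (-((P.α + β + 1) * P.η))

theorem gaugeP_sub_gaugeQ (β : ℂ) :
    P.gaugeP β - P.gaugeQ β = -2 * exp (-((P.α + 1) * P.η)) * sinh (β * P.η) := by
  have h1 : P.gaugeP β = exp (-((P.α + 1) * P.η)) * exp (-(β * P.η)) := by
    rw [gaugeP, ← exp_add]; ring_nf
  have h2 : P.gaugeQ β = exp (-((P.α + 1) * P.η)) * exp (β * P.η) := by
    rw [gaugeQ, ← exp_add]; ring_nf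
  rw [h1, h2, sinh]
  ring

theorem gaugeP_ne_gaugeQ {β : ℂ} (hβ : sinh (β * P.η) ≠ 0) : P.gaugeP β - P.gaugeQ β ≠ 0 := by
  rw [gaugeP_sub_gaugeQ]
  exact mul_ne_zero (mul_ne_zero (by norm_num) (exp_ne_zero _)) hβ

theorem gaugeQ_add_two (β : ℂ) : P.gaugeQ (β + 2) = P.gaugeQ β * exp P.η ^ 2 := by
  rw [gaugeQ, gaugeQ, ← exp_nat_mul, ← exp_add]
  push_cast
  ring_nf

theorem gaugeG_eq (l β : ℂ) :
    P.gaugeG l β = !![P.gaugeP β * exp (-l), P.gaugeQ β * exp (-l); 1, 1] := by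
  ext i j
  fin_cases i <;> fin_cases j <;>
    simp [gaugeG, colX, colY, gaugeP, gaugeQ, ← exp_add] <;> ring_nf

theorem gaugeG_inv {β : ℂ} (hβ : sinh (β * P.η) ≠ 0) (l : ℂ) :
    (P.gaugeG (l - P.η / 2) β)⁻¹ = (P.gaugeP β - P.gaugeQ β)⁻¹ •
      !![exp (l - P.η / 2), -P.gaugeQ β; -exp (l - P.η / 2), P.gaugeP β] := by
  refine Matrix.inv_eq_right_inv ?_
  have h := P.gaugeP_ne_gaugeQ hβ
  have hX := exp_ne_zero (l - P.η / 2)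
  rw [gaugeG_eq, exp_neg]
  generalize P.gaugeP β = p at *
  generalize P.gaugeQ β = q at *
  ext i j
  fin_cases i <;> fin_cases j <;> simp <;> field_simp <;> ring

theorem gaugedU_apply {β : ℂ} (hβ : sinh (β * P.η) ≠ 0) (l : ℂ) :
    P.opB l β = (P.gaugeP β - P.gaugeQ β)⁻¹ • P.bOp l (P.gaugeQ β) ∧
      P.opD l β = (exp (l - P.η / 2))⁻¹ • P.dOp l (P.gaugeQ β) -
        (P.gaugeP β - P.gaugeQ β)⁻¹ • P.bOp l (P.gaugeQ β) := by
  have h := P.gaugeP_ne_gaugeQ hβ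
  have hX := exp_ne_zero (l - P.η / 2)
  have h1 : exp (-l + P.η / 2) = (exp (l - P.η / 2))⁻¹ := by rw [← exp_neg]; ring_nf
  have h2 : exp (-(P.η / 2 - l)) = exp (l - P.η / 2) := by ring_nf
  simp only [opB, opD, gaugedU, gaugeG_inv P hβ, gaugeG_eq P (P.η / 2 - l), onAux, bOp, dOp, bForm,
    dForm, Matrix.smul_apply, Matrix.mul_apply, Fin.sum_univ_two, Matrix.map_apply, h1, h2,
    Algebra.algebraMap_eq_smul_one]
  generalize P.gaugeP β = p at *
  generalize P.gaugeQ β = q at *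
  generalize exp (l - P.η / 2) = X at *
  constructor <;> simp [smul_smul] <;> match_scalars <;> field_simp <;> ring

theorem refKet_eq_refVec (β : ℂ) : P.refKet (-β + 2) = P.refVec (P.gaugeQ β) := by
  ext h
  refine Finset.prod_congr rfl fun n _ => ?_
  have : exp (-P.α * P.η - ((N : ℂ) - ((n : ℕ) + 1 : ℂ) + (-β + 2)) * P.η - P.ξ n) =
      P.gaugeQ β * exp (-(((N : ℂ) - (n : ℕ)) * P.η) - P.ξ n) := by
    rw [gaugeQ, ← exp_add]; ring_nf
  rw [this]

/-- The normalization of `sovKet` relative to `phi`. -/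
def sovCoef (β : ℂ) (h : Fin N → Fin 2) (n : Fin N) : ℂ :=
  ((exp (P.ξ n))⁻¹ * (P.coefF n β * P.eigA (P.η / 2 - P.ξ n))⁻¹) ^ (1 - (h n : ℕ))

/-- Each `𝒟₋(ξ_n + η/2|β)` meets a state on which its `bOp` part vanishes, because `n` does not
occur further right. What remains is `e^{-ξ_n}` times `dOp`. -/
theorem sovKetOrdered_eq {β : ℂ} (hβ : sinh (β * P.η) ≠ 0) (h : Fin N → Fin 2)
    {L : List (Fin N)} (hL : L.Nodup) :
    P.sovKetOrdered L β h =
      (L.map (P.sovCoef β h)).prod • P.phi (L.filter fun n => h n = 0) (P.gaugeQ β) := by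
  induction L with
  | nil => simp [sovKetOrdered, phi_nil, refKet_eq_refVec]
  | cons n L ih =>
    obtain ⟨hn, hL⟩ := List.nodup_cons.1 hL
    have h1 : P.sovKetOrdered (n :: L) β h =
        (((P.coefF n β * P.eigA (P.η / 2 - P.ξ n))⁻¹ • P.opD (P.ξ n + P.η / 2) β)
          ^ (1 - (h n : ℕ))).mulVec (P.sovKetOrdered L β h) := by
      simp [sovKetOrdered, Matrix.mulVec_mulVec]
    rw [h1, ih hL]
    have h01 : h n = 0 ∨ h n = 1 := by generalize h n = x; fin_cases x <;> simp
    rcases h01 with e | e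
    · have hn' : n ∉ L.filter fun n => h n = 0 := fun hm => hn (List.mem_of_mem_filter hm)
      rw [List.filter_cons_of_pos (by simp [e]), phi_cons, (P.gaugedU_apply hβ _).2]
      simp only [e, Fin.val_zero, Nat.sub_zero, pow_one, smul_mulVec, mulVec_smul, sub_mulVec,
        bOp_mulVec_phi_eq_zero P (hL.filter _) hn', smul_zero, sub_zero, List.map_cons,
        List.prod_cons, sovCoef, smul_smul, add_sub_cancel_right]
      congr 1
      ring
    · rw [List.filter_cons_of_neg (by simp [e])]
      simp [e, sovCoef]

theorem sovKet_eq {β : ℂ} (hβ : sinh (β * P.η) ≠ 0) (h : Fin N → Fin 2) :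
    P.sovKet β h = (∏ n, P.sovCoef β h n) •
      P.phi ((List.finRange N).filter fun n => h n = 0) (P.gaugeQ β) := by
  rw [sovKet, sovKetOrdered_eq P hβ h (List.nodup_finRange N)]
  congr 1

theorem occ_filter (h : Fin N → Fin 2) :
    occ ((List.finRange N).filter fun n => h n = 0) = h := by
  funext n
  simp only [occ, List.mem_filter, List.mem_finRange, true_and, decide_eq_true_eq]
  generalize h n = x
  fin_cases x <;> simp

theorem coefF_ne_zero (hξ : P.NonResonant) {β : ℂ} (hβ : sinh (β * P.η) ≠ 0)
    (hf : ∀ n, sinh (2 * P.ξ n + β * P.η) ≠ 0) (n : Fin N) : P.coefF n β ≠ 0 := by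
  have h1 := (hξ 1 (by simp)).2 n n
  have h2 := (hξ (-1) (by simp)).2 n n
  refine div_ne_zero (mul_ne_zero ?_ hβ) (mul_ne_zero ?_ (hf n))
  · convert h1 using 2; push_cast; ring
  · convert h2 using 2; push_cast; ring

theorem bConst_eq {β : ℂ} (hβ : sinh (β * P.η) ≠ 0) (l : ℂ) :
    (P.gaugeP β - P.gaugeQ β)⁻¹ * P.bConst l (P.gaugeQ β) =
      (-1) ^ N * exp ((β - N) * P.η) * (sinh (2 * l - P.η) *
        (2 * P.κ * sinh ((β - (1 + N + P.α)) * P.η - P.τ) - exp P.ζ) /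
      (2 * sinh P.ζ * sinh (β * P.η))) := by
  have h1 : P.gaugeQ β * exp (-(N * P.η)) = exp (-((P.α + 1) * P.η)) * exp ((β - N) * P.η) := by
    rw [gaugeQ, ← exp_add, ← exp_add]; ring_nf
  have h2 : exp ((β - (1 + N + P.α)) * P.η - P.τ) =
      exp (-((P.α + 1) * P.η)) * exp ((β - N) * P.η) / exp P.τ := by
    rw [← exp_add, ← exp_sub]; ring_nf
  rw [gaugeP_sub_gaugeQ, bConst, h1, bdryFactor, exp_neg P.τ, sinh_eq_of_exp_eq h2]
  have x1 := exp_ne_zero (-((P.α + 1) * P.η))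
  have x2 := exp_ne_zero ((β - N) * P.η)
  have x3 := exp_ne_zero P.τ
  generalize exp (-((P.α + 1) * P.η)) = a at *
  generalize exp ((β - N) * P.η) = b at *
  generalize exp P.τ = c at *
  -- With `sinh ζ = 0` both sides are zero, since division by zero gives zero.
  by_cases hζ : sinh P.ζ = 0
  · simp [hζ]
  · field_simp
    ring

theorem opB_mulVec_sovKet (hξ : P.NonResonant)
    {β : ℂ} (hβ : sinh (β * P.η) ≠ 0) (hβ₂ : sinh ((β + 2) * P.η) ≠ 0)
    (hf₂ : ∀ n, sinh (2 * P.ξ n + (β + 2) * P.η) ≠ 0) (h : Fin N → Fin 2) (l : ℂ) :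
    (P.opB l β).mulVec (P.sovKet β h) = P.eigBbar h l β • P.sovKet (β + 2) h := by
  rw [sovKet_eq P hβ, sovKet_eq P hβ₂, (P.gaugedU_apply hβ l).1, smul_mulVec, mulVec_smul,
    bOp_mulVec_phi P ((List.nodup_finRange N).filter _), gaugeQ_add_two, occ_filter, smul_smul,
    smul_smul, smul_smul]
  congr 1
  have h1 : ∏ n, P.sovCoef β h n =
      (∏ n, (P.coefF n (β + 2) / P.coefF n β) ^ (1 - (h n : ℕ))) *
        ∏ n, P.sovCoef (β + 2) h n := by
    rw [← Finset.prod_mul_distrib]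
    refine Finset.prod_congr rfl fun n _ => ?_
    have := P.coefF_ne_zero hξ hβ₂ hf₂ n
    rw [sovCoef, sovCoef, ← mul_pow]
    congr 1
    rw [mul_inv, mul_inv]
    field_simp
  rw [h1, eigBbar]
  linear_combination (∏ n, (P.coefF n (β + 2) / P.coefF n β) ^ (1 - (h n : ℕ))) *
    (∏ n, P.sovCoef (β + 2) h n) * (P.fnAh h l * P.fnAh h (-l)) * P.bConst_eq hβ l

/-- The factor of index `n` in `d(ξ_n - η/2)` is `sinh(-η)`. -/
theorem sinh_eta_ne_zero {n : Fin N} (hA : P.eigA (P.η / 2 - P.ξ n) ≠ 0) : sinh P.η ≠ 0 := by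
  have h1 : P.fnD (-(P.η / 2 - P.ξ n)) ≠ 0 := right_ne_zero_of_mul hA
  rw [fnD, fnA, Finset.prod_ne_zero_iff] at h1
  have h2 := h1 n (Finset.mem_univ n)
  rw [← neg_ne_zero, ← sinh_neg]
  convert h2 using 2
  ring

/-- Vanishing means `e^ζ = 2κ sinh w`, with `w` the argument of `sinh` in the pseudo-eigenvalue.
Adding the two boundary relations gives `e^ζ = 2κ sinh(α₋ + β₋)`, so vanishing forces `sinh w =
sinh(α₋ + β₋)`. -/
theorem bdryFactor_ne_zero (hκ : P.κ ≠ 0) (hb : P.BoundaryRelation) {β : ℂ}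
    (hN : P.NonNilpotentRight β) : P.bdryFactor (P.gaugeQ β * exp (-(N * P.η))) ≠ 0 := by
  have h2 : exp ((β - (1 + N + P.α)) * P.η - P.τ) =
      P.gaugeQ β * exp (-(N * P.η)) / exp P.τ := by
    rw [gaugeQ, ← exp_add, ← exp_sub]; ring_nf
  have hs := sinh_eq_of_exp_eq h2
  have x0 : P.gaugeQ β * exp (-(N * P.η)) ≠ 0 := mul_ne_zero (exp_ne_zero _) (exp_ne_zero _)
  have x3 := exp_ne_zero P.τ
  generalize P.gaugeQ β * exp (-(N * P.η)) = Q at *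
  set w := (β - (1 + N + P.α)) * P.η - P.τ with hw
  intro h0
  have h3 : exp P.ζ = 2 * P.κ * sinh w := by
    rw [bdryFactor, exp_neg P.τ] at h0
    rw [hs]
    field_simp at h0 ⊢
    linear_combination h0
  have h4 : sinh w = sinh (P.αb + P.βb) := by
    have h5 : exp P.ζ = 2 * P.κ * sinh (P.αb + P.βb) := by
      rw [sinh_add, hb.1, hb.2, ← cosh_add_sinh]
      field_simp
      ring
    exact mul_left_cancel₀ (mul_ne_zero two_ne_zero hκ) (h3.symm.trans h5)
  have h6 : sin (w * I) = sin ((P.αb + P.βb) * I) := by rw [sin_mul_I, sin_mul_I, h4]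
  -- The two families of solutions are the even and the odd values of `k` in `NonNilpotentRight`.
  obtain ⟨k, hk | hk⟩ := sin_eq_sin_iff.1 h6
  · refine hN (-(2 * k)) ?_
    have e : w = P.αb + P.βb + 2 * k * Real.pi * I := by
      linear_combination I * hk + (w - (P.αb + P.βb)) * I_sq
    have : (-1 : ℂ) ^ (-(2 * k)) = 1 := by
      rw [_root_.zpow_neg, _root_.zpow_mul]; simp
    rw [this]
    push_cast
    linear_combination -hw - e
  · refine hN (2 * k + 1) ?_
    have e : w = -(P.αb + P.βb) - (2 * k + 1) * Real.pi * I := by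
      linear_combination (-I) * hk + (w + (P.αb + P.βb)) * I_sq
    have : (-1 : ℂ) ^ (2 * k + 1) = -1 := by
      rw [zpow_add₀ (by norm_num), _root_.zpow_mul]; simp
    rw [this]
    push_cast
    linear_combination -hw - e

theorem exists_basis_sovKet (hζ : sinh P.ζ ≠ 0) (hκ : P.κ ≠ 0) (hb : P.BoundaryRelation)
    (hξ : P.NonResonant) (hA : ∀ n, P.eigA (P.η / 2 - P.ξ n) ≠ 0) {β : ℂ}
    (hβ : sinh (β * P.η) ≠ 0) (hf : ∀ n, sinh (2 * P.ξ n + β * P.η) ≠ 0)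
    (hN : ∀ j : ℕ, j < N → P.NonNilpotentRight (β + 2 * j)) :
    ∃ b : Module.Basis (Fin N → Fin 2) ℂ (State N), ∀ h, b h = P.sovKet β h := by
  have hc : ∀ h, ∏ n, P.sovCoef β h n ≠ 0 := fun h =>
    Finset.prod_ne_zero_iff.2 fun n _ => pow_ne_zero _ (mul_ne_zero (inv_ne_zero (exp_ne_zero _))
      (inv_ne_zero (mul_ne_zero (P.coefF_ne_zero hξ hβ hf n) (hA n))))
  have hB : ∀ j < N, P.bdryFactor (P.gaugeQ β * exp (-(N * P.η)) * exp P.η ^ (2 * j)) ≠ 0 := by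
    intro j hj
    convert P.bdryFactor_ne_zero hκ hb (hN j hj) using 2
    rw [gaugeQ, gaugeQ, ← exp_nat_mul, ← exp_add, ← exp_add, ← exp_add]
    push_cast
    ring_nf
  have hspan : Submodule.span ℂ {ψ | ∃ L : List (Fin N), L.Nodup ∧ ψ = P.phi L (P.gaugeQ β)} = ⊤ :=
    span_phi_eq_top P hξ (fun hpos => P.sinh_eta_ne_zero (hA ⟨0, hpos⟩)) hζ _ hB
  have htop : ⊤ ≤ Submodule.span ℂ (Set.range (P.sovKet β)) := by
    rw [← hspan, Submodule.span_le]
    rintro _ ⟨L, hL, rfl⟩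
    -- `sovKet` lists the sites in increasing order while `L` is arbitrary, so `phi_perm` is needed
    -- to identify the two states.
    have hp : L.Perm ((List.finRange N).filter fun n => occ L n = 0) :=
      (List.perm_ext_iff_of_nodup hL ((List.nodup_finRange N).filter _)).2 fun n => by
        simp [occ]
    have hm : P.sovKet β (occ L) ∈ Submodule.span ℂ (Set.range (P.sovKet β)) :=
      Submodule.subset_span ⟨_, rfl⟩
    rw [sovKet_eq P hβ, ← phi_perm P hξ hp hL, Submodule.smul_mem_iff _ (hc _)] at hm
    exact hm
  refine ⟨basisOfTopLeSpanOfCardEqFinrank _ htop (by simp), fun h => ?_⟩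
  rw [coe_basisOfTopLeSpanOfCardEqFinrank]

theorem sovKetOrdered_perm (hξ : P.NonResonant) {β : ℂ} (hβ : sinh (β * P.η) ≠ 0)
    {L : List (Fin N)} (hL : L.Perm (List.finRange N)) (h : Fin N → Fin 2) :
    P.sovKetOrdered L β h = P.sovKet β h := by
  have hL' : L.Nodup := hL.nodup_iff.2 (List.nodup_finRange N)
  rw [sovKet, sovKetOrdered_eq P hβ h hL', sovKetOrdered_eq P hβ h (List.nodup_finRange N),
    (hL.map _).prod_eq, phi_perm P hξ (hL.filter _) (hL'.filter _)]

end Params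

end

end OpenXXZ

theorem mainTheorem5 {N : ℕ} (P : OpenXXZ.Params N) (β : ℂ)
    (hζ : Complex.sinh P.ζ ≠ 0) (hκ : P.κ ≠ 0) (hb : P.BoundaryRelation)
    (hξ : P.NonResonant)
    (hA : ∀ n, P.eigA (P.η / 2 - P.ξ n) ≠ 0)
    (hβ : Complex.sinh (β * P.η) ≠ 0) (hβ₂ : Complex.sinh ((β + 2) * P.η) ≠ 0)
    (hf : ∀ n, Complex.sinh (2 * P.ξ n + β * P.η) ≠ 0)
    (hf₂ : ∀ n, Complex.sinh (2 * P.ξ n + (β + 2) * P.η) ≠ 0) :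
    (∀ L : List (Fin N), L.Perm (List.finRange N) →
      ∀ h : Fin N → Fin 2, P.sovKetOrdered L β h = P.sovKet β h) ∧
    ((∀ j : ℕ, j < N → P.NonNilpotentRight (β + 2 * j)) →
      ∃ b : Module.Basis (Fin N → Fin 2) ℂ (OpenXXZ.State N), ∀ h, b h = P.sovKet β h) ∧
    (∀ (h : Fin N → Fin 2) (l : ℂ),
      (P.opB l β).mulVec (P.sovKet β h) = P.eigBbar h l β • P.sovKet (β + 2) h) :=
  ⟨fun _ hL h => P.sovKetOrdered_perm hξ hβ hL h,
    P.exists_basis_sovKet hζ hκ hb hξ hA hβ hf,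
    P.opB_mulVec_sovKet hξ hβ hβ₂ hf₂⟩
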